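/- Consider a human (position $p_H\in\mathbb R^3$, mass $m_H>0$, symmetric positive definite damping $D_H$) connected by a cable to an aerial robot (position $p_R\in\mathbb R^3$, symmetric positive definite virtual inertia $M_A$ and damping $D_A$): $$m_H\ddot p_H=-m_Hg\,e_z-D_H\dot p_H+f_c+f_g,\qquad M_A\ddot p_R=-D_A\dot p_R-f_c+u_A .$$ Here $e_z$ is the upward unit vector, $g>0$, and $f_c$ is the cable force: with $l_c=p_R-p_H$, $f_c=k(\|l_c\|-\ell)\,l_c/\|l_c\|$ if $\|l_c\|>\ell$ and $f_c=0$ otherwise, with constants $k,\ell>0$. The human is constrained to the ground: $e_z^\top\dot p_H=0$, and $f_g$ is the vertical reaction force for which $e_z^\top\ddot p_H=0$. Let $\gamma=[\gamma_x,\gamma_y,\gamma_z]^\top\neq 0$ be constant, let $u_A=\gamma+D_A\dot p_H$ (human-velocity feedback with the position-control part saturated to $\gamma$), and let $v^\star=D_H^{-1}[\gamma_x,\gamma_y,0]^\top$, assumed to be compatible with the ground constraint, i.e. $e_z^\top v^\star=0$. Suppose that $D_H-\tfrac14D_A\succ0$. Then: 1. From every position of the human there is a constant-velocity trajectory with $\dot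 p_H(t)=\dot p_R(t)=v^\star$ for all $t\ge 0$, and every trajectory on $[0,\infty)$ along which $\dot p_H$ and $\dot p_R$ are both constant has these velocities. 2. Every such trajectory is asymptotically stable, convergence of positions being understood up to a constant common displacement of human and robot (the closed loop is invariant under such displacements). That is, for every $\varepsilon>0$ there is $\delta>0$ such that from every initial state $(p_H,\dot p_H,p_R,\dot p_R)$ with $e_z^\top\dot p_H=0$ that is $\delta$-close to that of the trajectory there is a solution on $[0,\infty)$, and every such solution stays $\varepsilon$-close to the trajectory in all of $(p_H,\dot p_H,p_R,\dot p_R)$ for all $t\ge0$; and every solution that starts sufficiently close converges, as $t\to\infty$, to the trajectory displaced by some constant vector $c\in\mathbb R^3$ (in particular $\dot p_H,\dot p_R\to v^\star$ and $l_c$ converges to its value along the trajectory). 3. Along every such trajectory $f_c=\gamma$ for all $t\ge 0$, so the desired guiding force is rendered whatever the human's damping $D_H$. -/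

import Mathlib

/-- Vectors of `ℝ³` with the Euclidean norm, in an inertial frame whose third axis points upwards. -/
abbrev Vec3 : Type := EuclideanSpace ℝ (Fin 3)

/-- The upward unit vector. -/
noncomputable def zAxis : Vec3 := !₂[0, 0, 1]

/-- Action of a real `3 × 3` matrix on a vector of `ℝ³`. -/
noncomputable def actOn (A : Matrix (Fin 3) (Fin 3) ℝ) (v : Vec3) : Vec3 :=
  WithLp.toLp 2 (A.mulVec (WithLp.ofLp v))

/-- Physical parameters of the human--cable--robot system. For real matrices `Matrix.PosDef`
means symmetric and positive definite. -/
structure TetherParams where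
  /-- mass of the human -/
  massH : ℝ
  /-- gravitational constant -/
  grav : ℝ
  /-- elastic coefficient of the cable -/
  stiffness : ℝ
  /-- nominal length of the cable -/
  len : ℝ
  /-- apparent damping of the human -/
  DH : Matrix (Fin 3) (Fin 3) ℝ
  /-- virtual inertia of the robot -/
  MA : Matrix (Fin 3) (Fin 3) ℝ
  /-- virtual damping of the robot -/
  DA : Matrix (Fin 3) (Fin 3) ℝ
  massH_pos : 0 < massH
  grav_pos : 0 < grav
  stiffness_pos : 0 < stiffness
  len_pos : 0 < len
  DH_posDef : DH.PosDef
  MA_posDef : MA.PosDef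
  DA_posDef : DA.PosDef

/-- The state `(p_H, v_H, p_R, v_R)`: positions and velocities of the human and of the robot.
It carries the maximum of the four Euclidean norms. -/
abbrev TetherState : Type := Vec3 × Vec3 × Vec3 × Vec3

namespace TetherState

/-- position of the human -/
def posH (x : TetherState) : Vec3 := x.1

/-- velocity of the human -/
def velH (x : TetherState) : Vec3 := x.2.1

/-- position of the robot -/
def posR (x : TetherState) : Vec3 := x.2.2.1

/-- velocity of the robot -/
def velR (x : TetherState) : Vec3 := x.2.2.2

/-- The cable vector, from the human to the robot. -/
def cable (x : TetherState) : Vec3 := x.posR - x.posH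

/-- Displacement of the human and of the robot by the same constant vector `c`. -/
def translate (c : Vec3) (x : TetherState) : TetherState :=
  (x.posH + c, x.velH, x.posR + c, x.velR)

end TetherState

namespace TetherParams

/-- Intensity of the force in a cable whose ends are at distance `r`: a unilateral spring. -/
noncomputable def tension (P : TetherParams) (r : ℝ) : ℝ :=
  if 0 < r - P.len then P.stiffness * (r - P.len) else 0

/-- The force that the cable applies to the human. It is zero for a slack cable,
in particular when the cable vector vanishes. -/
noncomputable def cableForce (P : TetherParams) (x : TetherState) : Vec3 :=
  P.tension ‖x.cable‖ • (‖x.cable‖⁻¹ • x.cable)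

/-- The ground reaction force: the vertical force that keeps the human on the ground, that is,
that cancels the vertical component of all other forces on the human. -/
noncomputable def groundReaction (P : TetherParams) (x : TetherState) : Vec3 :=
  (P.massH * P.grav + actOn P.DH x.velH 2 - P.cableForce x 2) • zAxis

/-- Acceleration of the human. -/
noncomputable def accH (P : TetherParams) (x : TetherState) : Vec3 :=
  P.massH⁻¹ • (-((P.massH * P.grav) • zAxis) - actOn P.DH x.velH + P.cableForce x
    + P.groundReaction x)

/-- The ground reaction force makes the vertical acceleration of the human vanish. -/
theorem accH_vertical (P : TetherParams) (x : TetherState) : P.accH x 2 = 0 := by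
  simp [accH, groundReaction, zAxis]
  ring

/-- Acceleration of the robot under the admittance control with input `u`. -/
noncomputable def accR (P : TetherParams) (x : TetherState) (u : Vec3) : Vec3 :=
  actOn P.MA⁻¹ (-actOn P.DA x.velR - P.cableForce x + u)

/-- Right-hand side of the state equation, for the input `u`. -/
noncomputable def dynamics (P : TetherParams) (x : TetherState) (u : Vec3) : TetherState :=
  (x.velH, P.accH x, x.velR, P.accR x u)

/-- The control law that adds a feedback of the human velocity to a control law `Γ`. -/
noncomputable def velFeedback (P : TetherParams) (Γ : TetherState → Vec3) (x : TetherState) :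
    Vec3 :=
  Γ x + actOn P.DA x.velH

/-- `x` is a motion, for all times `t ≥ 0`, of the system in closed loop with the control law `U`:
it solves the state equation and the human does not leave the ground. -/
def IsMotion (P : TetherParams) (U : TetherState → Vec3) (x : ℝ → TetherState) : Prop :=
  ∀ t : ℝ, 0 ≤ t → (x t).velH 2 = 0 ∧
    HasDerivWithinAt x (P.dynamics (x t) (U (x t))) (Set.Ici 0) t

/-- Lyapunov stability of the motion `y`, in the full state: if the initial state `x₀`
(with horizontal human velocity) is close to `y 0`, then there is a motion from `x₀`, defined for
all `t ≥ 0`, and every such motion stays close to `y`. -/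
def IsStableMotion (P : TetherParams) (U : TetherState → Vec3) (y : ℝ → TetherState) : Prop :=
  ∀ ε : ℝ, 0 < ε → ∃ δ : ℝ, 0 < δ ∧ ∀ x₀ : TetherState, x₀.velH 2 = 0 → dist x₀ (y 0) < δ →
    (∃ x : ℝ → TetherState, P.IsMotion U x ∧ x 0 = x₀) ∧
    ∀ x : ℝ → TetherState, P.IsMotion U x → x 0 = x₀ → ∀ t : ℝ, 0 ≤ t → dist (x t) (y t) < ε

/-- Local attractivity of the motion `y`: every motion that starts close to `y 0` converges to `y`,
up to a constant displacement `c` of the whole system. Under a control law that does not depend on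
the absolute positions, every translate of a motion is a motion, so that the displacement
cannot be dispensed with. -/
def IsAttractiveMotion (P : TetherParams) (U : TetherState → Vec3) (y : ℝ → TetherState) : Prop :=
  ∃ δ : ℝ, 0 < δ ∧ ∀ x : ℝ → TetherState, P.IsMotion U x → dist (x 0) (y 0) < δ →
    ∃ c : Vec3, Filter.Tendsto (fun t => dist (x t) ((y t).translate c)) Filter.atTop (nhds 0)

/-- Asymptotic stability of a motion of a system that is invariant under translations. -/
def IsAsymptoticallyStableMotion (P : TetherParams) (U : TetherState → Vec3)
    (y : ℝ → TetherState) : Prop :=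
  P.IsStableMotion U y ∧ P.IsAttractiveMotion U y

/-- The velocity `D_H⁻¹ [γ_x, γ_y, 0]ᵀ`. -/
noncomputable def vStar (P : TetherParams) (γ : Vec3) : Vec3 :=
  actOn P.DH⁻¹ !₂[γ 0, γ 1, 0]

end TetherParams

/-! Let `a` and `b` be the deviations of the human and robot velocities from `vStar`, `q` that of
the cable from `restCable`, the only cable vector with force `γ`, and `φ` the force deviation. While
the cable is taut, the kinetic energies plus the spring energy under the load `γ` change at the rate
`-⟨a, DH a⟩ - ⟨b, DA b⟩ + ⟨b, DA a⟩`; the ground does no work, since `a` is horizontal. Completing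
the square turns this into `-⟨a, (DH - DA/4) a⟩ - ⟨b - a/2, DA (b - a/2)⟩`, which is negative
definite in `(a, b)` but does not see `q`.

A small cross term `η ⟨q, MA b⟩` repairs this: its derivative contains `-η ⟨q, φ⟩`, and the spring
force is strongly monotone near a taut cable (`springForce_strongly_monotone`). The result is a
strict Lyapunov function (`exists_strict_lyapunov`), and `lyapunov_trapping` keeps the cable taut,
so `a`, `b` and `q` decay exponentially. Positions follow by integrating the velocity error: its
integral is small, which gives stability, and it converges, which gives the displacement `c`.

For the uniqueness of the velocities, zero acceleration fixes the cable force; unequal velocities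
would stretch the cable without bound, and equal ones are determined by the horizontal force
balance. -/

/-! ### The unilateral spring: force, equilibrium and energy. -/

section CableField

variable {E : Type*} [NormedAddCommGroup E] [InnerProductSpace ℝ E]

/-- The force of a unilateral spring of stiffness `k` and nominal length `ℓ`, as a function of the
cable vector. -/
noncomputable def springForce (k ℓ : ℝ) (l : E) : E := (k * (1 - ℓ / max ‖l‖ ℓ)) • l

theorem springForce_of_le {k ℓ : ℝ} {l : E} (h : ℓ ≤ ‖l‖) :
    springForce k ℓ l = (k * (1 - ℓ / ‖l‖)) • l := by
  rw [springForce, max_eq_left h]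

theorem springForce_of_ge {k ℓ : ℝ} (hℓ : 0 < ℓ) {l : E} (h : ‖l‖ ≤ ℓ) :
    springForce k ℓ l = 0 := by
  rw [springForce, max_eq_right h, div_self hℓ.ne']; simp

/-- The scalar factor lies in `[0, k]`, and its variation, multiplied by `b`, costs at most another
`k ‖a - b‖` because `‖b‖ ≤ max ‖b‖ ℓ`. This global bound yields solutions for all times, also
through slack phases. -/
theorem norm_springForce_sub_le {k ℓ : ℝ} (hk : 0 < k) (hℓ : 0 < ℓ) (a b : E) :
    ‖springForce k ℓ a - springForce k ℓ b‖ ≤ 2 * k * ‖a - b‖ := by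
  set ra := max ‖a‖ ℓ with hra
  set rb := max ‖b‖ ℓ with hrb
  have ha : 0 < ra := lt_max_of_lt_right hℓ
  have hb : 0 < rb := lt_max_of_lt_right hℓ
  have haℓ : ℓ ≤ ra := le_max_right _ _
  have hbb : ‖b‖ ≤ rb := le_max_left _ _
  have hab : |ra - rb| ≤ ‖a - b‖ :=
    (abs_max_sub_max_le_abs _ _ _).trans (abs_norm_sub_norm_le a b)
  have hsplit : springForce k ℓ a - springForce k ℓ b =
      (k * (1 - ℓ / ra)) • (a - b) + (k * (ℓ / ra) * ((ra - rb) / rb)) • b := by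
    have : k * (1 - ℓ / rb) = k * (1 - ℓ / ra) - k * (ℓ / ra) * ((ra - rb) / rb) := by
      field_simp; ring
    rw [springForce, springForce, ← hra, ← hrb, this]
    module
  have h0 : 0 ≤ 1 - ℓ / ra := sub_nonneg.2 ((div_le_one ha).2 haℓ)
  have h1 : ℓ / ra ≤ 1 := (div_le_one ha).2 haℓ
  have h2 : 0 ≤ ℓ / ra := by positivity
  have hA : ‖(k * (1 - ℓ / ra)) • (a - b)‖ ≤ k * ‖a - b‖ := by
    rw [norm_smul, Real.norm_of_nonneg (by positivity)]
    gcongr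
    nlinarith
  have hB : ‖(k * (ℓ / ra) * ((ra - rb) / rb)) • b‖ ≤ k * ‖a - b‖ := by
    rw [norm_smul, norm_mul, norm_mul, norm_div (ra - rb), Real.norm_of_nonneg hk.le,
      Real.norm_of_nonneg h2, Real.norm_of_nonneg hb.le, Real.norm_eq_abs]
    have : |ra - rb| / rb * ‖b‖ ≤ ‖a - b‖ := by
      rw [div_mul_eq_mul_div, div_le_iff₀ hb]
      exact mul_le_mul hab hbb (norm_nonneg _) (norm_nonneg _)
    calc k * (ℓ / ra) * (|ra - rb| / rb) * ‖b‖ = k * (ℓ / ra) * (|ra - rb| / rb * ‖b‖) := by ring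
      _ ≤ k * 1 * ‖a - b‖ := by gcongr
      _ = k * ‖a - b‖ := by ring
  rw [hsplit]
  refine (norm_add_le _ _).trans ?_
  linarith

/-- The cable vector at which the spring force equals `γ`. -/
noncomputable def restCable (k ℓ : ℝ) (γ : E) : E := ((ℓ + ‖γ‖ / k) / ‖γ‖) • γ

theorem norm_restCable {k ℓ : ℝ} (hk : 0 < k) (hℓ : 0 < ℓ) {γ : E} (hγ : γ ≠ 0) :
    ‖restCable k ℓ γ‖ = ℓ + ‖γ‖ / k := by
  have : 0 < ‖γ‖ := norm_pos_iff.2 hγ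
  rw [restCable, norm_smul, Real.norm_of_nonneg (by positivity), div_mul_cancel₀ _ this.ne']

theorem lt_norm_restCable {k ℓ : ℝ} (hk : 0 < k) (hℓ : 0 < ℓ) {γ : E} (hγ : γ ≠ 0) :
    ℓ < ‖restCable k ℓ γ‖ := by
  have : 0 < ‖γ‖ := norm_pos_iff.2 hγ
  rw [norm_restCable hk hℓ hγ]
  linarith [div_pos this hk]

theorem springForce_restCable {k ℓ : ℝ} (hk : 0 < k) (hℓ : 0 < ℓ) {γ : E} (hγ : γ ≠ 0) :
    springForce k ℓ (restCable k ℓ γ) = γ := by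
  have h : 0 < ‖γ‖ := norm_pos_iff.2 hγ
  rw [springForce_of_le (lt_norm_restCable hk hℓ hγ).le, norm_restCable hk hℓ hγ, restCable,
    smul_smul]
  have : k * (1 - ℓ / (ℓ + ‖γ‖ / k)) * ((ℓ + ‖γ‖ / k) / ‖γ‖) = 1 := by
    have : ℓ + ‖γ‖ / k ≠ 0 := by positivity
    field_simp; ring
  rw [this, one_smul]

theorem norm_springForce_ge {k ℓ : ℝ} (hk : 0 < k) (hℓ : 0 < ℓ) (l : E) :
    k * (‖l‖ - ℓ) ≤ ‖springForce k ℓ l‖ := by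
  rcases le_total ‖l‖ ℓ with h | h
  · exact (mul_nonpos_of_nonneg_of_nonpos hk.le (by linarith)).trans (norm_nonneg _)
  · have hl : 0 < ‖l‖ := hℓ.trans_le h
    have : 0 ≤ 1 - ℓ / ‖l‖ := sub_nonneg.2 ((div_le_one hl).2 h)
    rw [springForce_of_le h, norm_smul, Real.norm_of_nonneg (by positivity)]
    apply le_of_eq; field_simp

/-- A nonzero force means a taut cable, so `l` is a positive multiple of `γ`; the magnitude of the
force then fixes its length. -/
theorem eq_restCable {k ℓ : ℝ} (hk : 0 < k) (hℓ : 0 < ℓ) {γ l : E} (hγ : γ ≠ 0)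
    (h : springForce k ℓ l = γ) : l = restCable k ℓ γ := by
  have hl : ℓ < ‖l‖ := by
    by_contra! hc
    exact hγ (h.symm.trans (springForce_of_ge hℓ hc))
  have hl0 : 0 < ‖l‖ := hℓ.trans hl
  rw [springForce_of_le hl.le] at h
  have h1 : 0 < 1 - ℓ / ‖l‖ := sub_pos.2 ((div_lt_one hl0).2 hl)
  have hn : ‖γ‖ = k * (1 - ℓ / ‖l‖) * ‖l‖ := by
    rw [← h, norm_smul, Real.norm_of_nonneg (by positivity)]
  rw [restCable, hn, ← h, smul_smul]
  have : (ℓ + k * (1 - ℓ / ‖l‖) * ‖l‖ / k) / (k * (1 - ℓ / ‖l‖) * ‖l‖) * (k * (1 - ℓ / ‖l‖)) = 1 := by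
    have h1' := h1.ne'
    rw [div_mul_eq_mul_div, div_eq_one_iff_eq (by positivity)]
    field_simp
    ring
  rw [this, one_smul]

/-- Potential energy of a taut spring under the constant load `γ`. -/
noncomputable def springEnergy (k ℓ : ℝ) (γ l : E) : ℝ :=
  k / 2 * (‖l‖ - ℓ) ^ 2 - inner ℝ γ l

theorem real_inner_eq_norm_sub (l l' : E) :
    inner ℝ l l' = (‖l‖ ^ 2 + ‖l'‖ ^ 2 - ‖l - l'‖ ^ 2) / 2 := by
  rw [norm_sub_sq_real]; ring

/-- In terms of `‖l‖`, `‖l'‖` and `‖l - l'‖` the difference of the two sides is a sum of nonnegative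
terms. The constant depends only on the reference `l'`; `l` need only be taut. -/
theorem springForce_strongly_monotone {k ℓ : ℝ} (hk : 0 < k) (hℓ : 0 < ℓ) {l l' : E}
    (hl : ℓ ≤ ‖l‖) (hl' : ℓ < ‖l'‖) :
    k / 2 * (1 - ℓ / ‖l'‖) * ‖l - l'‖ ^ 2 ≤
      inner ℝ (l - l') (springForce k ℓ l - springForce k ℓ l') := by
  have h0 : 0 < ‖l‖ := hℓ.trans_le hl
  have h0' : 0 < ‖l'‖ := hℓ.trans hl'
  rw [springForce_of_le hl, springForce_of_le hl'.le]
  simp only [inner_sub_left, inner_sub_right, inner_smul_right, real_inner_self_eq_norm_sq,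
    real_inner_comm l l']
  rw [real_inner_eq_norm_sub l l']
  set r := ‖l‖
  set s := ‖l'‖
  set d := ‖l - l'‖
  have key : k * (1 - ℓ / r) * (r ^ 2 - (r ^ 2 + s ^ 2 - d ^ 2) / 2) -
      k * (1 - ℓ / s) * ((r ^ 2 + s ^ 2 - d ^ 2) / 2 - s ^ 2) -
      k / 2 * (1 - ℓ / s) * d ^ 2 =
      k / 2 * (1 - ℓ / r) * d ^ 2 + k / 2 * (ℓ / r + ℓ / s) * (r - s) ^ 2 := by
    field_simp
    ring
  have : 0 ≤ 1 - ℓ / r := sub_nonneg.2 ((div_le_one h0).2 hl)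
  have : 0 ≤ k / 2 * (1 - ℓ / r) * d ^ 2 + k / 2 * (ℓ / r + ℓ / s) * (r - s) ^ 2 := by positivity
  linarith

/-- The linear term cancels because `l'` is a critical point of the energy under its own force.
Nothing is asked of `l`, so the quadratic bounds drawn from this identity are global. -/
theorem springEnergy_sub_eq {k ℓ : ℝ} {l l' : E} (hl' : ℓ < ‖l'‖) (hℓ : 0 < ℓ) :
    springEnergy k ℓ (springForce k ℓ l') l - springEnergy k ℓ (springForce k ℓ l') l' =
      k / 2 * ((1 - ℓ / ‖l'‖) * ‖l - l'‖ ^ 2 + ℓ / ‖l'‖ * (‖l‖ - ‖l'‖) ^ 2) := by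
  have h0' : 0 < ‖l'‖ := hℓ.trans hl'
  rw [springForce_of_le hl'.le, springEnergy, springEnergy]
  simp only [inner_smul_left, real_inner_self_eq_norm_sq, conj_trivial]
  rw [real_inner_comm, real_inner_eq_norm_sub l l']
  field_simp
  ring

theorem springEnergy_sub_ge {k ℓ : ℝ} (hk : 0 < k) (hℓ : 0 < ℓ) {l l' : E} (hl' : ℓ < ‖l'‖) :
    k / 2 * (1 - ℓ / ‖l'‖) * ‖l - l'‖ ^ 2 ≤
      springEnergy k ℓ (springForce k ℓ l') l - springEnergy k ℓ (springForce k ℓ l') l' := by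
  have h0' : 0 < ‖l'‖ := hℓ.trans hl'
  rw [springEnergy_sub_eq hl' hℓ]
  have : 0 ≤ k / 2 * (ℓ / ‖l'‖ * (‖l‖ - ‖l'‖) ^ 2) := by positivity
  linarith

theorem springEnergy_sub_le {k ℓ : ℝ} (hk : 0 < k) (hℓ : 0 < ℓ) {l l' : E} (hl' : ℓ < ‖l'‖) :
    springEnergy k ℓ (springForce k ℓ l') l - springEnergy k ℓ (springForce k ℓ l') l' ≤
      k / 2 * ‖l - l'‖ ^ 2 := by
  have h0' : 0 < ‖l'‖ := hℓ.trans hl'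
  rw [springEnergy_sub_eq hl' hℓ]
  have h1 : (‖l‖ - ‖l'‖) ^ 2 ≤ ‖l - l'‖ ^ 2 :=
    sq_le_sq' (by linarith [abs_le.1 (abs_norm_sub_norm_le l l')])
      (by linarith [abs_le.1 (abs_norm_sub_norm_le l l')])
  have h2 : ℓ / ‖l'‖ * (‖l‖ - ‖l'‖) ^ 2 ≤ ℓ / ‖l'‖ * ‖l - l'‖ ^ 2 := by gcongr
  have : k / 2 * ((1 - ℓ / ‖l'‖) * ‖l - l'‖ ^ 2 + ℓ / ‖l'‖ * (‖l‖ - ‖l'‖) ^ 2) ≤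
      k / 2 * ((1 - ℓ / ‖l'‖) * ‖l - l'‖ ^ 2 + ℓ / ‖l'‖ * ‖l - l'‖ ^ 2) := by gcongr
  linarith

/-- Tautness is essential: `springEnergy` continues the taut formula below length `ℓ`, where its
gradient is no longer the force minus the load. -/
theorem hasDerivWithinAt_springEnergy {k ℓ : ℝ} (hℓ : 0 < ℓ) {γ : E} {l : ℝ → E} {l' : E}
    {s : Set ℝ} {t : ℝ} (hl : HasDerivWithinAt l l' s t) (h : ℓ ≤ ‖l t‖) :
    HasDerivWithinAt (fun t => springEnergy k ℓ γ (l t))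
      (inner ℝ (springForce k ℓ (l t) - γ) l') s t := by
  have h0 : 0 < ‖l t‖ := hℓ.trans_le h
  have hn : HasDerivWithinAt (fun t => ‖l t‖) (inner ℝ (l t) l' / ‖l t‖) s t := by
    have := (hl.norm_sq).sqrt (by positivity)
    simp only [Real.sqrt_sq (norm_nonneg _)] at this
    convert this using 1
    field_simp
  have := (((hn.sub_const ℓ).pow 2).const_mul (k / 2)).sub
    ((hasDerivWithinAt_const t s γ).inner ℝ hl)
  refine this.congr_deriv ?_
  rw [springForce_of_le h, inner_sub_left, inner_smul_left]
  simp
  field_simp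

end CableField

/-! ### Global solutions, exponentially decaying derivatives, trapping. -/

section LipschitzODE

variable {E : Type*} [NormedAddCommGroup E] [NormedSpace ℝ E]

/-- On the ball of radius `‖f x‖` about `x` the field is at most `(1 + K) ‖f x‖`, so a solution
cannot leave it within the stated time. That time does not depend on `x`, which allows pieces to be
concatenated. -/
theorem LipschitzWith.exists_solution_Icc [CompleteSpace E] {f : E → E} {K : NNReal}
    (hf : LipschitzWith K f) (x : E) :
    ∃ α : ℝ → E, α 0 = x ∧ ∀ t ∈ Set.Icc (0 : ℝ) (1 / (2 * (K + 1))),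
      HasDerivWithinAt α (f (α t)) (Set.Icc 0 (1 / (2 * (K + 1)))) t := by
  have hT : (0 : ℝ) ≤ 1 / (2 * (K + 1)) := by positivity
  have hp : IsPicardLindelof (fun _ => f) (tmin := 0) (tmax := 1 / (2 * ((K : ℝ) + 1)))
      ⟨0, le_rfl, hT⟩ x ‖f x‖₊ 0 ((1 + K) * ‖f x‖₊) K := by
    refine IsPicardLindelof.of_time_independent (fun y hy => ?_) hf.lipschitzOnWith ?_
    · have h1 := hf.norm_sub_le y x
      have h2 : ‖y - x‖ ≤ ‖f x‖ := by simpa [dist_eq_norm] using hy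
      have h3 := norm_le_norm_add_norm_sub' (f y) (f x)
      have h4 : (K : ℝ) * ‖y - x‖ ≤ K * ‖f x‖ := by gcongr
      push_cast
      linarith
    · simp only [sub_zero, sub_self, max_eq_left hT]
      push_cast
      rw [mul_one_div, sub_zero, div_le_iff₀ (by positivity)]
      nlinarith [norm_nonneg (f x), K.2, mul_nonneg K.2 (norm_nonneg (f x))]
  exact hp.exists_eq_forall_mem_Icc_hasDerivWithinAt₀

/-- A Lipschitz vector field has solutions that are defined for all positive times. -/
theorem LipschitzWith.exists_solution_Ici [CompleteSpace E] {f : E → E} {K : NNReal}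
    (hf : LipschitzWith K f) (x₀ : E) :
    ∃ α : ℝ → E, α 0 = x₀ ∧ ∀ t ∈ Set.Ici (0 : ℝ),
      HasDerivWithinAt α (f (α t)) (Set.Ici 0) t := by
  choose φ hφ0 hφ using hf.exists_solution_Icc
  set T : ℝ := 1 / (2 * (K + 1)) with hTdef
  have hT : 0 < T := by positivity
  let X : ℕ → E := fun n => Nat.rec x₀ (fun _ y => φ y T) n
  have hX (n : ℕ) : X (n + 1) = φ (X n) T := rfl
  let α : ℝ → E := fun t => φ (X ⌊t / T⌋₊) (t - ⌊t / T⌋₊ * T)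
  have hα (n : ℕ) : ∀ t ∈ Set.Icc (n * T) ((n + 1 : ℕ) * T), α t = φ (X n) (t - n * T) := by
    intro t ht
    rcases ht.2.lt_or_eq with h | h
    · have : ⌊t / T⌋₊ = n := by
        rw [Nat.floor_eq_iff (div_nonneg (le_trans (by positivity) ht.1) hT.le),
          le_div_iff₀ hT, div_lt_iff₀ hT]
        exact ⟨ht.1, by simpa using h⟩
      simp only [α, this]
    · have : ⌊t / T⌋₊ = n + 1 := by rw [h, mul_div_cancel_right₀ _ hT.ne', Nat.floor_natCast]
      simp only [α, this]
      rw [h, sub_self, hφ0, hX]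
      congr 1
      push_cast; ring
  have hderiv (n : ℕ) : ∀ t ∈ Set.Icc (n * T) ((n + 1 : ℕ) * T),
      HasDerivWithinAt α (f (α t)) (Set.Icc (n * T) ((n + 1 : ℕ) * T)) t := by
    intro t ht
    have hmaps : Set.MapsTo (fun s => s - n * T) (Set.Icc (n * T) ((n + 1 : ℕ) * T))
        (Set.Icc 0 T) := by
      intro s hs
      have h1 := hs.1
      have h2 := hs.2
      push_cast at h2
      exact ⟨by linarith, by linarith⟩
    have := (hφ (X n) _ (hmaps ht)).scomp t ((hasDerivWithinAt_id t _).sub_const (n * T)) hmaps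
    rw [one_smul] at this
    rw [hα n t ht]
    exact this.congr (fun s hs => hα n s hs) (hα n t ht)
  refine ⟨α, by simp [α, X, hφ0], fun t ht => ?_⟩
  have ht0 : 0 ≤ t := ht
  have hright : HasDerivWithinAt α (f (α t)) (Set.Ici t) t := by
    have h1 : ⌊t / T⌋₊ * T ≤ t := by
      rw [← le_div_iff₀ hT]; exact Nat.floor_le (div_nonneg ht0 hT.le)
    have h2 : t < (⌊t / T⌋₊ + 1 : ℕ) * T := by
      rw [← div_lt_iff₀ hT]; exact_mod_cast Nat.lt_floor_add_one _
    exact (hderiv _ t ⟨h1, h2.le⟩).mono_of_mem_nhdsWithin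
      (Filter.mem_of_superset (Icc_mem_nhdsGE h2) (Set.Icc_subset_Icc_left h1))
  rcases ht0.eq_or_lt with rfl | hpos
  · exact hright
  -- The ceiling selects a piece that begins strictly before `t`, hence a left neighbourhood even
  -- when `t` is a node; the floor did the same on the right.
  have hleft : HasDerivWithinAt α (f (α t)) (Set.Iic t) t := by
    obtain ⟨n, hn⟩ : ∃ n, ⌈t / T⌉₊ = n + 1 :=
      Nat.exists_eq_succ_of_ne_zero (Nat.ceil_pos.2 (by positivity)).ne'
    have h1 : n * T < t := by
      rw [← lt_div_iff₀ hT]; exact Nat.lt_ceil.1 (by omega)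
    have h2 : t ≤ (n + 1 : ℕ) * T := by
      rw [← div_le_iff₀ hT, ← hn]; exact Nat.le_ceil _
    exact (hderiv _ t ⟨h1.le, h2⟩).mono_of_mem_nhdsWithin
      (Filter.mem_of_superset (Icc_mem_nhdsLE h1) (Set.Icc_subset_Icc_right h2))
  have := hleft.union hright
  rw [Set.Iic_union_Ici] at this
  exact this.mono (Set.subset_univ _)

/-- A function whose derivative decays exponentially varies little. -/
theorem norm_sub_le_of_norm_deriv_le_exp {q q' : ℝ → E} {C μ : ℝ} (hμ : 0 < μ)
    (hq : ∀ t ∈ Set.Ici (0 : ℝ), HasDerivWithinAt q (q' t) (Set.Ici 0) t)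
    (hq' : ∀ t ∈ Set.Ici (0 : ℝ), ‖q' t‖ ≤ C * Real.exp (-μ * t)) {s t : ℝ} (hs : 0 ≤ s)
    (hst : s ≤ t) : ‖q t - q s‖ ≤ C / μ * (Real.exp (-μ * s) - Real.exp (-μ * t)) := by
  have hB (r : ℝ) : HasDerivAt (fun r => C / μ * (Real.exp (-μ * s) - Real.exp (-μ * r)))
      (C * Real.exp (-μ * r)) r := by
    have h := (((hasDerivAt_id r).const_mul (-μ)).exp.const_sub
      (Real.exp (-μ * s))).const_mul (C / μ)
    refine h.congr_deriv ?_
    simp only [id]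
    field_simp
  refine image_norm_le_of_norm_deriv_right_le_deriv_boundary (a := s) (b := t)
    (f := fun r => q r - q s) (f' := q') ?_ ?_ (by simp) hB ?_ ⟨hst, le_rfl⟩
  · exact fun r hr => (((hq r (hs.trans hr.1)).continuousWithinAt).mono
      (fun y hy => hs.trans hy.1)).sub continuousWithinAt_const
  · exact fun r hr => ((hq r (hs.trans hr.1)).mono
      (Set.Ici_subset_Ici.2 (hs.trans hr.1))).sub_const _
  · exact fun r hr => hq' r (hs.trans hr.1)

theorem exists_tendsto_of_norm_deriv_le_exp [CompleteSpace E] {q q' : ℝ → E} {C μ : ℝ}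
    (hμ : 0 < μ)
    (hq : ∀ t ∈ Set.Ici (0 : ℝ), HasDerivWithinAt q (q' t) (Set.Ici 0) t)
    (hq' : ∀ t ∈ Set.Ici (0 : ℝ), ‖q' t‖ ≤ C * Real.exp (-μ * t)) :
    ∃ c, Filter.Tendsto q Filter.atTop (nhds c) := by
  have hC : 0 ≤ C := by
    have := (norm_nonneg _).trans (hq' 0 (Set.mem_Ici.2 le_rfl))
    simpa using this
  have hlim : Filter.Tendsto (fun s => C / μ * Real.exp (-μ * s)) Filter.atTop (nhds 0) := by
    have h := (Real.tendsto_exp_atBot.comp (Filter.tendsto_id.const_mul_atTop_of_neg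
      (neg_neg_of_pos hμ))).const_mul (C / μ)
    simpa using h
  refine cauchy_map_iff_exists_tendsto.1 (Metric.cauchy_iff.2 ⟨inferInstance, fun ε hε => ?_⟩)
  obtain ⟨N, hN0, hN⟩ := ((Filter.eventually_ge_atTop (0 : ℝ)).and
    (hlim.eventually (gt_mem_nhds (half_pos hε)))).exists
  have hb : ∀ t ∈ Set.Ici N, ‖q t - q N‖ < ε / 2 := by
    intro t ht
    refine (norm_sub_le_of_norm_deriv_le_exp hμ hq hq' hN0 ht).trans_lt (lt_of_le_of_lt ?_ hN)
    have := (Real.exp_pos (-μ * t)).le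
    gcongr
    linarith
  refine ⟨q '' Set.Ici N, Filter.image_mem_map (Filter.mem_atTop N), ?_⟩
  rintro _ ⟨s, hs, rfl⟩ _ ⟨t, ht, rfl⟩
  have h1 := hb s hs
  have h2 := hb t ht
  rw [← dist_eq_norm] at h1 h2
  linarith [dist_triangle_right (q s) (q t) (q N)]

/-- Lyapunov's method: as long as `g < ρ`, the function `w` dominates `g ^ 2` and decays at rate
`κ`; then `g` cannot reach `ρ` if `w` starts below `α * ρ ^ 2`. -/
theorem lyapunov_trapping {g w w' : ℝ → ℝ} {α κ ρ : ℝ} (hα : 0 < α) (hκ : 0 < κ)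
    (hg : ContinuousOn g (Set.Ici 0))
    (hw : ∀ t ∈ Set.Ici (0 : ℝ), g t ≤ ρ → HasDerivWithinAt w (w' t) (Set.Ici 0) t)
    (hlow : ∀ t ∈ Set.Ici (0 : ℝ), g t ≤ ρ → α * g t ^ 2 ≤ w t)
    (hdec : ∀ t ∈ Set.Ici (0 : ℝ), g t ≤ ρ → w' t ≤ -κ * w t)
    (hg0 : g 0 < ρ) (hw0 : w 0 < α * ρ ^ 2) :
    ∀ t ∈ Set.Ici (0 : ℝ), g t < ρ ∧ w t ≤ w 0 * Real.exp (-κ * t) := by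
  have hdecay : ∀ t ∈ Set.Ici (0 : ℝ), (∀ s ∈ Set.Icc 0 t, g s ≤ ρ) →
      w t ≤ w 0 * Real.exp (-κ * t) := by
    intro t ht hs
    have hd : ∀ s ∈ Set.Icc 0 t, HasDerivWithinAt (fun s => w s * Real.exp (κ * s))
        (w' s * Real.exp (κ * s) + w s * (Real.exp (κ * s) * κ)) (Set.Ici 0) s := by
      intro s hs'
      have h := (hw s hs'.1 (hs s hs')).mul
        (((hasDerivAt_id s).const_mul κ).exp.hasDerivWithinAt (s := Set.Ici 0))
      rw [mul_one] at h
      exact h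
    have hanti : AntitoneOn (fun s => w s * Real.exp (κ * s)) (Set.Icc 0 t) := by
      refine antitoneOn_of_hasDerivWithinAt_nonpos (convex_Icc 0 t)
        (f' := fun s => w' s * Real.exp (κ * s) + w s * (Real.exp (κ * s) * κ)) ?_ ?_ ?_
      · exact fun s hs' => (hd s hs').continuousWithinAt.mono fun y hy => hy.1
      · intro s hs'
        have hs'' := interior_subset hs'
        exact (hd s hs'').mono fun y hy => (interior_subset hy).1
      · intro s hs'
        have hs'' := interior_subset hs'
        have := hdec s hs''.1 (hs s hs'')
        nlinarith [Real.exp_pos (κ * s)]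
    have h := hanti ⟨le_rfl, ht⟩ ⟨ht, le_rfl⟩ ht
    simp only [mul_zero, Real.exp_zero, mul_one] at h
    rw [neg_mul, Real.exp_neg, ← div_eq_mul_inv, le_div_iff₀ (Real.exp_pos _)]
    exact h
  have hlt : ∀ t ∈ Set.Ici (0 : ℝ), g t < ρ := by
    by_contra! hcon
    obtain ⟨t₁, ht₁, hgt₁⟩ := hcon
    have hc1 : ContinuousOn g (Set.Icc 0 t₁) := hg.mono fun y hy => hy.1
    -- The first time `τ` at which `g` reaches `ρ`: the decay still holds up to `τ`, so `α * ρ ^ 2 ≤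
    -- w τ ≤ w 0 < α * ρ ^ 2`.
    set S := Set.Icc 0 t₁ ∩ g ⁻¹' Set.Ici ρ with hS
    have hScl : IsClosed S := hc1.preimage_isClosed_of_isClosed isClosed_Icc isClosed_Ici
    have hSne : S.Nonempty := ⟨t₁, ⟨ht₁, le_rfl⟩, hgt₁⟩
    have hSbdd : BddBelow S := ⟨0, fun y hy => hy.1.1⟩
    have hmem := hScl.csInf_mem hSne hSbdd
    set τ := sInf S
    have hbefore : ∀ s ∈ Set.Ico 0 τ, g s < ρ := by
      intro s hs
      by_contra! h
      exact (csInf_le hSbdd ⟨⟨hs.1, hs.2.le.trans hmem.1.2⟩, h⟩).not_gt hs.2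
    have hτ0 : 0 < τ := by
      rcases hmem.1.1.eq_or_lt with h | h
      · have : ρ ≤ g τ := hmem.2
        rw [← h] at this
        linarith
      · exact h
    have hτle : g τ ≤ ρ := by
      have hcl : τ ∈ closure (Set.Ico 0 τ) := by
        rw [closure_Ico hτ0.ne]; exact ⟨hτ0.le, le_rfl⟩
      exact ContinuousWithinAt.closure_le hcl
        ((hg τ hτ0.le).mono fun y hy => hy.1) continuousWithinAt_const
        fun s hs => (hbefore s hs).le
    have hgτ : g τ = ρ := le_antisymm hτle hmem.2
    have h1 := hdecay τ hτ0.le fun s hs => hs.2.lt_or_eq.elim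
      (fun h => (hbefore s ⟨hs.1, h⟩).le) (fun h => h ▸ hτle)
    have h2 := hlow τ hτ0.le hτle
    have h3 : 0 ≤ w 0 := le_trans (by positivity) (hlow 0 (Set.mem_Ici.2 le_rfl) hg0.le)
    have h4 : Real.exp (-κ * τ) ≤ 1 := Real.exp_le_one_iff.2 (by nlinarith)
    rw [hgτ] at h2
    nlinarith
  exact fun t ht => ⟨hlt t ht, hdecay t ht fun s hs => (hlt s hs.1).le⟩

end LipschitzODE

/-! ### Quadratic estimates behind the Lyapunov function. -/

section StrictLyapunov

variable {E : Type*} [NormedAddCommGroup E] [InnerProductSpace ℝ E]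

/-- Dissipation of the interconnection of two dampers with velocity feedback. -/
theorem dissipation_le {DH DA : E →L[ℝ] E} {c₁ c₂ : ℝ}
    (h₁ : ∀ v, c₁ * ‖v‖ ^ 2 ≤ inner ℝ v (DH v - (1 / 4 : ℝ) • DA v))
    (h₂ : ∀ v, c₂ * ‖v‖ ^ 2 ≤ inner ℝ v (DA v)) (hsym : ∀ v w, inner ℝ (DA v) w = inner ℝ v (DA w))
    (h₁0 : 0 < c₁) (h₂0 : 0 < c₂) (a b : E) :
    -inner ℝ a (DH a) - inner ℝ b (DA b) + inner ℝ b (DA a) ≤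
      -(min c₁ c₂ / 2) * (‖a‖ ^ 2 + ‖b‖ ^ 2) := by
  -- Completing the square in `b`; this is the origin of the factor `1 / 4`.
  have e : -inner ℝ a (DH a) - inner ℝ b (DA b) + inner ℝ b (DA a) =
      -inner ℝ a (DH a - (1 / 4 : ℝ) • DA a) -
        inner ℝ (b - (1 / 2 : ℝ) • a) (DA (b - (1 / 2 : ℝ) • a)) := by
    have : inner ℝ a (DA b) = inner ℝ b (DA a) := by rw [← hsym, real_inner_comm]
    simp only [map_sub, map_smul, inner_sub_left, inner_sub_right, inner_smul_left,
      inner_smul_right, conj_trivial, this]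
    ring
  have hb : ‖b‖ ^ 2 ≤ 2 * ‖b - (1 / 2 : ℝ) • a‖ ^ 2 + ‖a‖ ^ 2 / 2 := by
    have h := norm_le_norm_add_norm_sub' b ((1 / 2 : ℝ) • a)
    rw [norm_smul, Real.norm_of_nonneg (by norm_num)] at h
    have h' := pow_le_pow_left₀ (norm_nonneg b) h 2
    nlinarith [sq_nonneg (1 / 2 * ‖a‖ - ‖b - (1 / 2 : ℝ) • a‖)]
  have k₁ := h₁ a
  have k₂ := h₂ (b - (1 / 2 : ℝ) • a)
  have m₁ : min c₁ c₂ * ‖a‖ ^ 2 ≤ c₁ * ‖a‖ ^ 2 := by gcongr; exact min_le_left _ _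
  have m₂ : min c₁ c₂ * ‖b - (1 / 2 : ℝ) • a‖ ^ 2 ≤ c₂ * ‖b - (1 / 2 : ℝ) • a‖ ^ 2 := by
    gcongr; exact min_le_right _ _
  have m₀ : 0 < min c₁ c₂ := lt_min h₁0 h₂0
  have hb' := mul_le_mul_of_nonneg_left hb m₀.le
  have : 0 ≤ min c₁ c₂ * ‖a‖ ^ 2 := by positivity
  rw [e]
  linarith

/-- The energy plus a small cross term is a strict Lyapunov function for the interconnection. -/
theorem exists_strict_lyapunov {DH DA M : E →L[ℝ] E} {m c₁ c₂ c₃ u β₀ μ : ℝ}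
    (h₁ : ∀ v, c₁ * ‖v‖ ^ 2 ≤ inner ℝ v (DH v - (1 / 4 : ℝ) • DA v))
    (h₂ : ∀ v, c₂ * ‖v‖ ^ 2 ≤ inner ℝ v (DA v)) (hsym : ∀ v w, inner ℝ (DA v) w = inner ℝ v (DA w))
    (h₃ : ∀ v, c₃ * ‖v‖ ^ 2 ≤ inner ℝ v (M v))
    (hm : 0 < m) (h₁0 : 0 < c₁) (h₂0 : 0 < c₂) (h₃0 : 0 < c₃) (hu : 0 < u) (hβ₀ : 0 < β₀)
    (hμ : 0 < μ) :
    ∃ η α β κ : ℝ, 0 < α ∧ 0 < β ∧ 0 < κ ∧ ∀ a b q : E,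
      (∀ U : ℝ, u * ‖q‖ ^ 2 ≤ U → U ≤ β₀ * ‖q‖ ^ 2 →
        α * (‖a‖ ^ 2 + ‖b‖ ^ 2 + ‖q‖ ^ 2) ≤
          m / 2 * ‖a‖ ^ 2 + 1 / 2 * inner ℝ b (M b) + U + η * inner ℝ q (M b) ∧
        m / 2 * ‖a‖ ^ 2 + 1 / 2 * inner ℝ b (M b) + U + η * inner ℝ q (M b) ≤
          β * (‖a‖ ^ 2 + ‖b‖ ^ 2 + ‖q‖ ^ 2)) ∧
      (∀ φ : E, μ * ‖q‖ ^ 2 ≤ inner ℝ q φ →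
        -inner ℝ a (DH a) - inner ℝ b (DA b) + inner ℝ b (DA a) +
          η * (inner ℝ (b - a) (M b) - inner ℝ q (DA (b - a)) - inner ℝ q φ) ≤
          -κ * (‖a‖ ^ 2 + ‖b‖ ^ 2 + ‖q‖ ^ 2)) := by
  obtain ⟨C, hC, hCM, hCD⟩ : ∃ C : ℝ, 0 < C ∧ ‖M‖ ≤ C ∧ ‖DA‖ ≤ C :=
    ⟨‖M‖ + ‖DA‖ + 1, by positivity, by linarith [norm_nonneg DA], by linarith [norm_nonneg M]⟩
  have hMv (v : E) : ‖M v‖ ≤ C * ‖v‖ := M.le_of_opNorm_le hCM v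
  have hDv (v : E) : ‖DA v‖ ≤ C * ‖v‖ := DA.le_of_opNorm_le hCD v
  have hin (v w : E) : |inner ℝ v (M w)| ≤ C * (‖v‖ * ‖w‖) :=
    (abs_real_inner_le_norm _ _).trans
      ((mul_le_mul_of_nonneg_left (hMv w) (norm_nonneg v)).trans_eq (by ring))
  obtain ⟨c, hc, hdiss⟩ : ∃ c : ℝ, 0 < c ∧ ∀ a b : E,
      -inner ℝ a (DH a) - inner ℝ b (DA b) + inner ℝ b (DA a) ≤ -c * (‖a‖ ^ 2 + ‖b‖ ^ 2) :=
    ⟨min c₁ c₂ / 2, half_pos (lt_min h₁0 h₂0), dissipation_le h₁ h₂ hsym h₁0 h₂0⟩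
  set K : ℝ := 2 * C + C ^ 2 / μ with hK
  have hK0 : 0 < K := by positivity
  -- The cross term must be small three times over: its derivative may use up half of the damping
  -- `c`, and its value must not spoil definiteness in `b` or in `q`.
  obtain ⟨η, hη, hη₁, hη₂, hη₃⟩ : ∃ η : ℝ, 0 < η ∧ η * K ≤ c / 2 ∧ η * C ≤ c₃ / 2 ∧ η * C ≤ u := by
    refine ⟨min (c / 2 / K) (min (c₃ / 2 / C) (u / C)), by positivity, ?_, ?_, ?_⟩
    · rw [← le_div_iff₀ hK0]; exact min_le_left _ _
    · rw [← le_div_iff₀ hC]; exact (min_le_right _ _).trans (min_le_left _ _)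
    · rw [← le_div_iff₀ hC]; exact (min_le_right _ _).trans (min_le_right _ _)
  refine ⟨η, min (m / 2) (min (c₃ / 4) (u / 2)), m / 2 + C + β₀ + η * C, min (c / 2) (η * μ / 2),
    by positivity, by positivity, by positivity, fun a b q => ⟨fun U hU₁ hU₂ => ?_, fun φ hφ => ?_⟩⟩
  · have hcross : |η * inner ℝ q (M b)| ≤ η * C / 2 * (‖q‖ ^ 2 + ‖b‖ ^ 2) := by
      rw [abs_mul, abs_of_pos hη]
      have := mul_le_mul_of_nonneg_left (hin q b) hη.le
      nlinarith [mul_nonneg (mul_pos hη hC).le (sq_nonneg (‖q‖ - ‖b‖))]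
    obtain ⟨hcr₁, hcr₂⟩ := abs_le.1 hcross
    have hMb := h₃ b
    have hMb' := (le_abs_self _).trans (hin b b)
    have e₁ := mul_le_mul_of_nonneg_right hη₂ (sq_nonneg ‖b‖)
    have e₂ := mul_le_mul_of_nonneg_right hη₃ (sq_nonneg ‖q‖)
    have ha := sq_nonneg ‖a‖
    have hb := sq_nonneg ‖b‖
    have hq := sq_nonneg ‖q‖
    constructor
    · have m₁ : min (m / 2) (min (c₃ / 4) (u / 2)) * ‖a‖ ^ 2 ≤ m / 2 * ‖a‖ ^ 2 := by
        gcongr; exact min_le_left _ _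
      have m₂ : min (m / 2) (min (c₃ / 4) (u / 2)) * ‖b‖ ^ 2 ≤ c₃ / 4 * ‖b‖ ^ 2 := by
        gcongr; exact (min_le_right _ _).trans (min_le_left _ _)
      have m₃ : min (m / 2) (min (c₃ / 4) (u / 2)) * ‖q‖ ^ 2 ≤ u / 2 * ‖q‖ ^ 2 := by
        gcongr; exact (min_le_right _ _).trans (min_le_right _ _)
      linarith
    · have hηC : 0 < η * C := by positivity
      have p₁ := mul_nonneg hm.le hb
      have p₂ := mul_nonneg hm.le hq
      have p₃ := mul_nonneg hC.le ha
      have p₄ := mul_nonneg hC.le hb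
      have p₅ := mul_nonneg hC.le hq
      have p₆ := mul_nonneg hβ₀.le ha
      have p₇ := mul_nonneg hβ₀.le hb
      have p₈ := mul_nonneg hηC.le ha
      have p₉ := mul_nonneg hηC.le hb
      have p₁₀ := mul_nonneg hηC.le hq
      linarith
  · have hab : ‖b - a‖ ≤ ‖a‖ + ‖b‖ := (norm_sub_le _ _).trans_eq (add_comm _ _)
    have t₁ : inner ℝ (b - a) (M b) ≤ 2 * C * (‖a‖ ^ 2 + ‖b‖ ^ 2) := by
      have h := (le_abs_self _).trans (hin (b - a) b)
      have h' : C * (‖b - a‖ * ‖b‖) ≤ C * ((‖a‖ + ‖b‖) * ‖b‖) := by gcongr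
      have h'' : C * ((‖a‖ + ‖b‖) * ‖b‖) ≤ C * (2 * (‖a‖ ^ 2 + ‖b‖ ^ 2)) := by
        refine mul_le_mul_of_nonneg_left ?_ hC.le
        nlinarith [sq_nonneg (‖a‖ - ‖b‖), sq_nonneg ‖a‖]
      linarith
    -- Young's inequality, weighted so that only half of the gain `μ * ‖q‖ ^ 2` is spent.
    have t₂ : -inner ℝ q (DA (b - a)) ≤ μ / 2 * ‖q‖ ^ 2 + C ^ 2 / μ * (‖a‖ ^ 2 + ‖b‖ ^ 2) := by
      have h := (neg_le_abs _).trans (abs_real_inner_le_norm q (DA (b - a)))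
      have h' : ‖q‖ * ‖DA (b - a)‖ ≤ ‖q‖ * (C * (‖a‖ + ‖b‖)) := by
        gcongr
        exact (hDv _).trans (by gcongr)
      have h'' : ‖q‖ * (C * (‖a‖ + ‖b‖)) ≤
          μ / 2 * ‖q‖ ^ 2 + C ^ 2 / (2 * μ) * (‖a‖ + ‖b‖) ^ 2 := by
        have e : μ / 2 * ‖q‖ ^ 2 + C ^ 2 / (2 * μ) * (‖a‖ + ‖b‖) ^ 2 -
            ‖q‖ * (C * (‖a‖ + ‖b‖)) = (μ * ‖q‖ - C * (‖a‖ + ‖b‖)) ^ 2 / (2 * μ) := by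
          field_simp; ring
        have : 0 ≤ (μ * ‖q‖ - C * (‖a‖ + ‖b‖)) ^ 2 / (2 * μ) := by positivity
        linarith
      have h₃ : C ^ 2 / (2 * μ) * (‖a‖ + ‖b‖) ^ 2 ≤
          C ^ 2 / (2 * μ) * (2 * (‖a‖ ^ 2 + ‖b‖ ^ 2)) := by
        gcongr
        nlinarith [sq_nonneg (‖a‖ - ‖b‖)]
      have h₄ : C ^ 2 / (2 * μ) * (2 * (‖a‖ ^ 2 + ‖b‖ ^ 2)) =
          C ^ 2 / μ * (‖a‖ ^ 2 + ‖b‖ ^ 2) := by field_simp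
      linarith
    have t₃ : η * (inner ℝ (b - a) (M b) - inner ℝ q (DA (b - a)) - inner ℝ q φ) ≤
        η * (K * (‖a‖ ^ 2 + ‖b‖ ^ 2) - μ / 2 * ‖q‖ ^ 2) := by
      refine mul_le_mul_of_nonneg_left ?_ hη.le
      rw [hK]
      linarith
    have t₄ : η * K * (‖a‖ ^ 2 + ‖b‖ ^ 2) ≤ c / 2 * (‖a‖ ^ 2 + ‖b‖ ^ 2) := by gcongr
    have m₁ : min (c / 2) (η * μ / 2) * (‖a‖ ^ 2 + ‖b‖ ^ 2) ≤ c / 2 * (‖a‖ ^ 2 + ‖b‖ ^ 2) := by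
      gcongr; exact min_le_left _ _
    have m₂ : min (c / 2) (η * μ / 2) * ‖q‖ ^ 2 ≤ η * μ / 2 * ‖q‖ ^ 2 := by
      gcongr; exact min_le_right _ _
    have := hdiss a b
    linarith

end StrictLyapunov

/-! ### Positive definite matrices as coercive operators. -/

section MatrixAction

/-- The action of a matrix on `ℝ³` as a continuous linear map. -/
noncomputable def actCLM (A : Matrix (Fin 3) (Fin 3) ℝ) : Vec3 →L[ℝ] Vec3 :=
  Matrix.toEuclideanCLM (n := Fin 3) (𝕜 := ℝ) A

theorem actOn_eq_actCLM (A : Matrix (Fin 3) (Fin 3) ℝ) (v : Vec3) : actOn A v = actCLM A v := rfl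

theorem inner_actCLM (A : Matrix (Fin 3) (Fin 3) ℝ) (v w : Vec3) :
    inner ℝ v (actCLM A w) = WithLp.ofLp v ⬝ᵥ A.mulVec (WithLp.ofLp w) :=
  Matrix.inner_toEuclideanCLM A v w

theorem Matrix.PosDef.inner_actCLM_comm {A : Matrix (Fin 3) (Fin 3) ℝ} (hA : A.PosDef)
    (v w : Vec3) : inner ℝ (actCLM A v) w = inner ℝ v (actCLM A w) := by
  have hT : A.transpose = A := by simpa [Matrix.IsHermitian] using hA.1
  rw [real_inner_comm, inner_actCLM, inner_actCLM, Matrix.dotProduct_mulVec, ← Matrix.mulVec_transpose,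
    hT, dotProduct_comm]

/-- The constant is the minimum of the quadratic form on the compact unit sphere; homogeneity does
the rest. -/
theorem Matrix.PosDef.exists_pos_le_inner_actCLM {A : Matrix (Fin 3) (Fin 3) ℝ} (hA : A.PosDef) :
    ∃ c : ℝ, 0 < c ∧ ∀ v : Vec3, c * ‖v‖ ^ 2 ≤ inner ℝ v (actCLM A v) := by
  have hpos : ∀ v : Vec3, v ≠ 0 → 0 < inner ℝ v (actCLM A v) := by
    intro v hv
    rw [inner_actCLM]
    have h : WithLp.ofLp v ≠ 0 := fun h => hv (by ext i; simpa using congrFun h i)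
    simpa using (Matrix.posDef_iff_dotProduct_mulVec.1 hA).2 h
  have hcont : Continuous fun v : Vec3 => inner ℝ v (actCLM A v) := by fun_prop
  obtain ⟨v₀, hv₀, hmin⟩ := (isCompact_sphere (0 : Vec3) 1).exists_isMinOn
    (NormedSpace.sphere_nonempty.2 zero_le_one) hcont.continuousOn
  have hv₀' : v₀ ≠ 0 := by
    rintro rfl
    simp at hv₀
  refine ⟨_, hpos v₀ hv₀', fun v => ?_⟩
  rcases eq_or_ne v 0 with rfl | hv
  · simp
  have hn : 0 < ‖v‖ := norm_pos_iff.2 hv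
  have h : inner ℝ v₀ (actCLM A v₀) ≤ inner ℝ (‖v‖⁻¹ • v) (actCLM A (‖v‖⁻¹ • v)) :=
    hmin (by simp [norm_smul, hn.ne'])
  rw [map_smul, inner_smul_left, inner_smul_right, conj_trivial] at h
  calc inner ℝ v₀ (actCLM A v₀) * ‖v‖ ^ 2
      ≤ ‖v‖⁻¹ * (‖v‖⁻¹ * inner ℝ v (actCLM A v)) * ‖v‖ ^ 2 := by gcongr
    _ = inner ℝ v (actCLM A v) := by field_simp

theorem Matrix.PosDef.actCLM_actCLM_inv {A : Matrix (Fin 3) (Fin 3) ℝ} (hA : A.PosDef) (v : Vec3) :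
    actCLM A (actCLM A⁻¹ v) = v := by
  rw [← actOn_eq_actCLM, ← actOn_eq_actCLM]
  simp only [actOn, Matrix.mulVec_mulVec]
  rw [Matrix.mul_nonsing_inv A (A.isUnit_iff_isUnit_det.1 hA.isUnit)]
  simp

end MatrixAction

/-! ### Force balances and the components of a motion. -/

namespace TetherParams

open TetherState

theorem cableForce_eq_springForce (P : TetherParams) (x : TetherState) :
    P.cableForce x = springForce P.stiffness P.len x.cable := by
  rw [cableForce, tension]
  split_ifs with h
  · have h' : P.len ≤ ‖x.cable‖ := by linarith
    have h0 : 0 < ‖x.cable‖ := P.len_pos.trans_le h'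
    rw [springForce_of_le h', smul_smul]
    congr 1
    field_simp
  · rw [springForce_of_ge P.len_pos (by linarith), zero_smul]

theorem inner_zAxis (h : Vec3) : inner ℝ h zAxis = h 2 := by
  simp [zAxis, PiLp.inner_apply, Fin.sum_univ_three]

/-- The part of the human dynamics that is seen by a horizontal test vector. -/
theorem inner_accH (P : TetherParams) (x : TetherState) {h : Vec3} (hh : h 2 = 0) :
    P.massH * inner ℝ h (P.accH x) =
      -inner ℝ h (actCLM P.DH x.velH) +
        inner ℝ h (springForce P.stiffness P.len x.cable) := by
  have := P.massH_pos.ne'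
  rw [accH, groundReaction, inner_smul_right, mul_inv_cancel_left₀ this, actOn_eq_actCLM,
    ← cableForce_eq_springForce]
  simp only [inner_add_right, inner_sub_right, inner_neg_right, inner_smul_right, inner_zAxis, hh]
  ring

theorem actCLM_MA_accR (P : TetherParams) (x : TetherState) (u : Vec3) :
    actCLM P.MA (P.accR x u) =
      -actCLM P.DA x.velR - springForce P.stiffness P.len x.cable + u := by
  rw [accR, actOn_eq_actCLM, P.MA_posDef.actCLM_actCLM_inv, actOn_eq_actCLM,
    cableForce_eq_springForce]

/-- `DH` maps `vStar` to the horizontal part of `γ`, and a horizontal vector does not see the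
vertical part. -/
theorem inner_actCLM_DH_vStar (P : TetherParams) (γ : Vec3) {h : Vec3} (hh : h 2 = 0) :
    inner ℝ h (actCLM P.DH (P.vStar γ)) = inner ℝ h γ := by
  rw [vStar, actOn_eq_actCLM, P.DH_posDef.actCLM_actCLM_inv]
  simp [PiLp.inner_apply, Fin.sum_univ_three, hh]

/-- A horizontal velocity at which the horizontal forces on the human balance the load `γ`. -/
theorem eq_vStar (P : TetherParams) {γ v : Vec3} (hground : P.vStar γ 2 = 0) (hv : v 2 = 0)
    (h : ∀ e : Vec3, e 2 = 0 → inner ℝ e (actCLM P.DH v) = inner ℝ e γ) : v = P.vStar γ := by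
  obtain ⟨c, hc, hpos⟩ := P.DH_posDef.exists_pos_le_inner_actCLM
  have hd : (v - P.vStar γ) 2 = 0 := by simp [hv, hground]
  have h1 := hpos (v - P.vStar γ)
  rw [map_sub, inner_sub_right, h _ hd, P.inner_actCLM_DH_vStar γ hd, sub_self] at h1
  by_contra hne
  have : 0 < ‖v - P.vStar γ‖ := norm_pos_iff.2 (sub_ne_zero.2 hne)
  have : 0 < c * ‖v - P.vStar γ‖ ^ 2 := by positivity
  linarith

section Motion

variable {P : TetherParams} {U : TetherState → Vec3} {x : ℝ → TetherState}

theorem IsMotion.hasDerivWithinAt_posH (hx : P.IsMotion U x) {t : ℝ} (ht : 0 ≤ t) :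
    HasDerivWithinAt (fun t => (x t).posH) (x t).velH (Set.Ici 0) t :=
  (ContinuousLinearMap.fst ℝ Vec3 (Vec3 × Vec3 × Vec3)).hasFDerivAt.comp_hasDerivWithinAt t
    (hx t ht).2

theorem IsMotion.hasDerivWithinAt_velH (hx : P.IsMotion U x) {t : ℝ} (ht : 0 ≤ t) :
    HasDerivWithinAt (fun t => (x t).velH) (P.accH (x t)) (Set.Ici 0) t :=
  ((ContinuousLinearMap.fst ℝ Vec3 (Vec3 × Vec3)).comp
    (ContinuousLinearMap.snd ℝ Vec3 (Vec3 × Vec3 × Vec3))).hasFDerivAt.comp_hasDerivWithinAt t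
    (hx t ht).2

theorem IsMotion.hasDerivWithinAt_posR (hx : P.IsMotion U x) {t : ℝ} (ht : 0 ≤ t) :
    HasDerivWithinAt (fun t => (x t).posR) (x t).velR (Set.Ici 0) t :=
  ((ContinuousLinearMap.fst ℝ Vec3 Vec3).comp ((ContinuousLinearMap.snd ℝ Vec3 (Vec3 × Vec3)).comp
    (ContinuousLinearMap.snd ℝ Vec3 (Vec3 × Vec3 × Vec3)))).hasFDerivAt.comp_hasDerivWithinAt t
    (hx t ht).2

theorem IsMotion.hasDerivWithinAt_velR (hx : P.IsMotion U x) {t : ℝ} (ht : 0 ≤ t) :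
    HasDerivWithinAt (fun t => (x t).velR) (P.accR (x t) (U (x t))) (Set.Ici 0) t :=
  ((ContinuousLinearMap.snd ℝ Vec3 Vec3).comp ((ContinuousLinearMap.snd ℝ Vec3 (Vec3 × Vec3)).comp
    (ContinuousLinearMap.snd ℝ Vec3 (Vec3 × Vec3 × Vec3)))).hasFDerivAt.comp_hasDerivWithinAt t
    (hx t ht).2

theorem IsMotion.hasDerivWithinAt_cable (hx : P.IsMotion U x) {t : ℝ} (ht : 0 ≤ t) :
    HasDerivWithinAt (fun t => (x t).cable) ((x t).velR - (x t).velH) (Set.Ici 0) t :=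
  (hx.hasDerivWithinAt_posR ht).sub (hx.hasDerivWithinAt_posH ht)

/-- A motion with constant velocities has no acceleration. -/
theorem IsMotion.acc_eq_zero (hx : P.IsMotion U x) {v w : Vec3}
    (h : ∀ t : ℝ, 0 ≤ t → (x t).velH = v ∧ (x t).velR = w) {t : ℝ} (ht : 0 ≤ t) :
    P.accH (x t) = 0 ∧ P.accR (x t) (U (x t)) = 0 := by
  have hu : UniqueDiffWithinAt ℝ (Set.Ici (0 : ℝ)) t := uniqueDiffOn_Ici 0 t ht
  constructor
  · exact hu.eq_deriv _ (hx.hasDerivWithinAt_velH ht)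
      ((hasDerivWithinAt_const t _ v).congr (fun s hs => (h s hs).1) (h t ht).1)
  · exact hu.eq_deriv _ (hx.hasDerivWithinAt_velR ht)
      ((hasDerivWithinAt_const t _ w).congr (fun s hs => (h s hs).2) (h t ht).2)

end Motion

/-! ### Steady motions and global existence in closed loop. -/

section ClosedLoop

variable {P : TetherParams} {γ : Vec3} {x : ℝ → TetherState}

/-- Without acceleration the robot equation is algebraic and can be solved for the cable force,
which is therefore constant in time. -/
theorem IsMotion.springForce_eq_of_velocity_const
    (hx : P.IsMotion (P.velFeedback fun _ => γ) x) {v w : Vec3}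
    (h : ∀ t : ℝ, 0 ≤ t → (x t).velH = v ∧ (x t).velR = w) {t : ℝ} (ht : 0 ≤ t) :
    springForce P.stiffness P.len (x t).cable = γ - actCLM P.DA (w - v) := by
  have h1 := P.actCLM_MA_accR (x t) (P.velFeedback (fun _ => γ) (x t))
  rw [(hx.acc_eq_zero h ht).2, map_zero, velFeedback, actOn_eq_actCLM, (h t ht).1, (h t ht).2] at h1
  have h2 : γ - (actCLM P.DA w - actCLM P.DA v) =
      springForce P.stiffness P.len (x t).cable + 0 := by
    rw [h1]; abel
  rw [map_sub, h2, add_zero]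

/-- In a motion without acceleration the cable does not move: otherwise its force would grow. -/
theorem IsMotion.velocities_eq (hx : P.IsMotion (P.velFeedback fun _ => γ) x) {v w : Vec3}
    (h : ∀ t : ℝ, 0 ≤ t → (x t).velH = v ∧ (x t).velR = w) : w = v := by
  by_contra hne
  have hd : 0 < ‖w - v‖ := norm_pos_iff.2 (sub_ne_zero.2 hne)
  have hcab (t : ℝ) (ht : 0 ≤ t) : (x t).cable = (x 0).cable + t • (w - v) := by
    have hder : ∀ s ∈ Set.Ici (0 : ℝ),
        HasDerivWithinAt (fun s => (x s).cable - s • (w - v)) 0 (Set.Ici 0) s := by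
      intro s hs
      have h1 := (hx.hasDerivWithinAt_cable hs).sub
        ((hasDerivWithinAt_id s _).smul_const (w - v))
      rw [(h s hs).1, (h s hs).2, one_smul, sub_self] at h1
      exact h1
    have h2 := (convex_Ici (0 : ℝ)).norm_image_sub_le_of_norm_hasDerivWithin_le (C := 0) hder
      (fun s _ => by simp) (Set.mem_Ici.2 le_rfl) (Set.mem_Ici.2 ht)
    rw [zero_mul, norm_le_zero_iff, zero_smul, sub_zero, sub_eq_zero] at h2
    rw [← h2, sub_add_cancel]
  set F := ‖γ - actCLM P.DA (w - v)‖
  have hF : 0 ≤ F := norm_nonneg _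
  have hk := P.stiffness_pos
  have hℓ := P.len_pos
  -- By this time the extension is at least `F / k + 1`, so the force is at least `F + k`, although
  -- its norm is `F`.
  set t : ℝ := (‖(x 0).cable‖ + P.len + F / P.stiffness + 1) / ‖w - v‖
  have ht : 0 ≤ t := by positivity
  have h1 := norm_springForce_ge hk hℓ (x t).cable
  rw [hx.springForce_eq_of_velocity_const h ht] at h1
  have h2 : t * ‖w - v‖ - ‖(x 0).cable‖ ≤ ‖(x t).cable‖ := by
    rw [hcab t ht]
    have := norm_sub_le_norm_add (t • (w - v)) (x 0).cable
    rw [norm_smul, Real.norm_of_nonneg ht] at this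
    rwa [add_comm (x 0).cable]
  have h3 : t * ‖w - v‖ = ‖(x 0).cable‖ + P.len + F / P.stiffness + 1 :=
    div_mul_cancel₀ _ hd.ne'
  have h4 : P.stiffness * (F / P.stiffness + 1) ≤ P.stiffness * (‖(x t).cable‖ - P.len) := by
    gcongr
    linarith
  have h5 : P.stiffness * (F / P.stiffness + 1) = F + P.stiffness := by field_simp
  linarith

theorem IsMotion.eq_vStar_of_velocity_const (hx : P.IsMotion (P.velFeedback fun _ => γ) x)
    (hground : P.vStar γ 2 = 0) {v w : Vec3}
    (h : ∀ t : ℝ, 0 ≤ t → (x t).velH = v ∧ (x t).velR = w) :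
    v = P.vStar γ ∧ w = P.vStar γ := by
  have hwv := hx.velocities_eq h
  have hv : v = P.vStar γ := by
    refine P.eq_vStar hground ?_ fun e he => ?_
    · rw [← (h 0 le_rfl).1]; exact (hx 0 le_rfl).1
    · have h1 := P.inner_accH (x 0) he
      rw [(hx.acc_eq_zero h le_rfl).1, hx.springForce_eq_of_velocity_const h le_rfl, hwv, sub_self,
        map_zero, sub_zero, inner_zero_right, (h 0 le_rfl).1] at h1
      linarith
  exact ⟨hv, hwv.trans hv⟩

theorem exists_steady_motion (P : TetherParams) {γ : Vec3} (hγ : γ ≠ 0)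
    (hground : P.vStar γ 2 = 0) (a : Vec3) :
    ∃ y : ℝ → TetherState, P.IsMotion (P.velFeedback fun _ => γ) y ∧
      (y 0).posH = a ∧ ∀ t : ℝ, 0 ≤ t → (y t).velH = P.vStar γ ∧ (y t).velR = P.vStar γ := by
  set v := P.vStar γ with hv
  set r := restCable P.stiffness P.len γ with hr
  refine ⟨fun t => (a + t • v, v, a + t • v + r, v), fun t _ => ⟨hground, ?_⟩,
    by simp [posH], fun t _ => ⟨rfl, rfl⟩⟩
  have hpos : HasDerivWithinAt (fun t : ℝ => a + t • v) v (Set.Ici 0) t := by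
    have := ((hasDerivWithinAt_id t (Set.Ici 0)).smul_const v).const_add a
    rwa [one_smul] at this
  have hcab : TetherState.cable (a + t • v, v, a + t • v + r, v) = r := by
    simp [cable, posR, posH]
  have hf : springForce P.stiffness P.len r = γ :=
    springForce_restCable P.stiffness_pos P.len_pos hγ
  -- The acceleration is itself horizontal, so it can serve as its own test vector in `inner_accH`.
  have hH : P.accH (a + t • v, v, a + t • v + r, v) = 0 := by
    have h1 := P.inner_accH (a + t • v, v, a + t • v + r, v)
      (P.accH_vertical (a + t • v, v, a + t • v + r, v))
    rw [hcab, hf, show TetherState.velH (a + t • v, v, a + t • v + r, v) = v from rfl,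
      P.inner_actCLM_DH_vStar γ (P.accH_vertical _), neg_add_cancel, mul_eq_zero] at h1
    exact inner_self_eq_zero.1 (h1.resolve_left P.massH_pos.ne')
  have hR : P.accR (a + t • v, v, a + t • v + r, v)
      (P.velFeedback (fun _ => γ) (a + t • v, v, a + t • v + r, v)) = 0 := by
    rw [accR, cableForce_eq_springForce, hcab, hf, velFeedback,
      show TetherState.velH (a + t • v, v, a + t • v + r, v) = v from rfl,
      show TetherState.velR (a + t • v, v, a + t • v + r, v) = v from rfl, actOn_eq_actCLM]
    convert map_zero (actCLM P.MA⁻¹) using 2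
    abel
  rw [dynamics, hH, hR]
  exact hpos.prodMk ((hasDerivWithinAt_const t _ v).prodMk
    ((hpos.add_const r).prodMk (hasDerivWithinAt_const t _ v)))

/-- The closed-loop vector field is Lipschitz. -/
theorem exists_lipschitzWith_dynamics (P : TetherParams) (γ : Vec3) :
    ∃ K : NNReal, LipschitzWith K fun x => P.dynamics x (P.velFeedback (fun _ => γ) x) := by
  have hspring : LipschitzWith (Real.toNNReal (2 * P.stiffness))
      (springForce P.stiffness P.len : Vec3 → Vec3) := by
    refine LipschitzWith.of_dist_le_mul fun a b => ?_
    have hk := P.stiffness_pos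
    rw [Real.coe_toNNReal _ (by positivity), dist_eq_norm, dist_eq_norm]
    exact norm_springForce_sub_le P.stiffness_pos P.len_pos a b
  have hposH : LipschitzWith 1 posH := LipschitzWith.prod_fst
  have hvelH : LipschitzWith (1 * 1) velH := LipschitzWith.prod_fst.comp LipschitzWith.prod_snd
  have hposR : LipschitzWith (1 * (1 * 1)) posR :=
    LipschitzWith.prod_fst.comp (LipschitzWith.prod_snd.comp LipschitzWith.prod_snd)
  have hvelR : LipschitzWith (1 * (1 * 1)) velR :=
    LipschitzWith.prod_snd.comp (LipschitzWith.prod_snd.comp LipschitzWith.prod_snd)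
  obtain ⟨Kf, hf⟩ : ∃ K, LipschitzWith K P.cableForce := by
    rw [show P.cableForce = fun x => springForce P.stiffness P.len x.cable from
      funext P.cableForce_eq_springForce]
    exact ⟨_, hspring.comp (hposR.sub hposH)⟩
  have hact (A : Matrix (Fin 3) (Fin 3) ℝ) : LipschitzWith ‖actCLM A‖₊ (actOn A) :=
    (actCLM A).lipschitz
  -- The vertical projection: gravity and reaction drop out, leaving `1 - z` applied to the cable
  -- and damping forces.
  let z : Vec3 →L[ℝ] Vec3 := (innerSL ℝ zAxis).smulRight zAxis
  have hz (v : Vec3) : z v = v 2 • zAxis := by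
    simp [z, real_inner_comm, inner_zAxis]
  obtain ⟨KH, hH⟩ : ∃ K, LipschitzWith K P.accH := by
    have h : P.accH = fun x => (P.massH⁻¹ • (ContinuousLinearMap.id ℝ Vec3 - z))
        (P.cableForce x - actOn P.DH x.velH) := by
      funext x
      simp only [accH, groundReaction, smul_apply,
        sub_apply, ContinuousLinearMap.id_apply, hz, PiLp.sub_apply]
      module
    rw [h]
    exact ⟨_, (ContinuousLinearMap.lipschitz _).comp (hf.sub ((hact P.DH).comp hvelH))⟩
  obtain ⟨KR, hR⟩ : ∃ K, LipschitzWith K fun x => P.accR x (P.velFeedback (fun _ => γ) x) :=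
    ⟨_, (hact P.MA⁻¹).comp ((((hact P.DA).comp hvelR).neg.sub hf).add
      ((LipschitzWith.const γ).add ((hact P.DA).comp hvelH)))⟩
  exact ⟨_, hvelH.prodMk (hH.prodMk (hvelR.prodMk hR))⟩

/-- The ground constraint is invariant: the vertical acceleration vanishes identically, so a
solution of the unconstrained equation keeps its zero vertical velocity. -/
theorem exists_motion (P : TetherParams) (γ : Vec3) {x₀ : TetherState} (h₀ : x₀.velH 2 = 0) :
    ∃ x : ℝ → TetherState, P.IsMotion (P.velFeedback fun _ => γ) x ∧ x 0 = x₀ := by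
  obtain ⟨K, hK⟩ := P.exists_lipschitzWith_dynamics γ
  obtain ⟨x, hx0, hx⟩ := hK.exists_solution_Ici x₀
  refine ⟨x, fun t ht => ⟨?_, hx t ht⟩, hx0⟩
  have hder : ∀ s ∈ Set.Ici (0 : ℝ),
      HasDerivWithinAt (fun s => (x s).velH 2) 0 (Set.Ici 0) s := by
    intro s hs
    have h := (((EuclideanSpace.proj (𝕜 := ℝ) (2 : Fin 3)).comp
      ((ContinuousLinearMap.fst ℝ Vec3 (Vec3 × Vec3)).comp
        (ContinuousLinearMap.snd ℝ Vec3 (Vec3 × Vec3 × Vec3)))).hasFDerivAt.comp_hasDerivWithinAt s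
          (hx s hs))
    exact h.congr_deriv (P.accH_vertical (x s))
  have h2 := (convex_Ici (0 : ℝ)).norm_image_sub_le_of_norm_hasDerivWithin_le (C := 0) hder
    (fun s _ => by simp) (Set.mem_Ici.2 le_rfl) (Set.mem_Ici.2 ht)
  rw [zero_mul, norm_le_zero_iff, sub_eq_zero, hx0, h₀] at h2
  exact h2

end ClosedLoop

end TetherParams

/-! ### Exponential decay along closed-loop motions. -/

namespace TetherParams

open TetherState

theorem dist_lt_iff {x z : TetherState} {ε : ℝ} :
    dist x z < ε ↔ ‖x.posH - z.posH‖ < ε ∧ ‖x.velH - z.velH‖ < ε ∧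
      ‖x.posR - z.posR‖ < ε ∧ ‖x.velR - z.velR‖ < ε := by
  rw [Prod.dist_eq, Prod.dist_eq, Prod.dist_eq, max_lt_iff, max_lt_iff, max_lt_iff]
  simp only [dist_eq_norm]
  rfl

theorem dist_le_iff {x z : TetherState} {ε : ℝ} :
    dist x z ≤ ε ↔ ‖x.posH - z.posH‖ ≤ ε ∧ ‖x.velH - z.velH‖ ≤ ε ∧
      ‖x.posR - z.posR‖ ≤ ε ∧ ‖x.velR - z.velR‖ ≤ ε := by
  rw [Prod.dist_eq, Prod.dist_eq, Prod.dist_eq, max_le_iff, max_le_iff, max_le_iff]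
  simp only [dist_eq_norm]
  rfl

/-- The derivative of the Lyapunov function along a motion of the closed loop. -/
theorem IsMotion.hasDerivWithinAt_lyapunov {P : TetherParams} {γ : Vec3} {x : ℝ → TetherState}
    (hx : P.IsMotion (P.velFeedback fun _ => γ) x) (hground : P.vStar γ 2 = 0) (η E₀ : ℝ)
    {r : Vec3} {t : ℝ} (ht : 0 ≤ t) (htaut : P.len ≤ ‖(x t).cable‖) :
    HasDerivWithinAt (fun t => P.massH / 2 * ‖(x t).velH - P.vStar γ‖ ^ 2 +
        1 / 2 * inner ℝ ((x t).velR - P.vStar γ) (actCLM P.MA ((x t).velR - P.vStar γ)) +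
        (springEnergy P.stiffness P.len γ (x t).cable - E₀) +
        η * inner ℝ ((x t).cable - r) (actCLM P.MA ((x t).velR - P.vStar γ)))
      (-inner ℝ ((x t).velH - P.vStar γ) (actCLM P.DH ((x t).velH - P.vStar γ)) -
        inner ℝ ((x t).velR - P.vStar γ) (actCLM P.DA ((x t).velR - P.vStar γ)) +
        inner ℝ ((x t).velR - P.vStar γ) (actCLM P.DA ((x t).velH - P.vStar γ)) +
        η * (inner ℝ (((x t).velR - P.vStar γ) - ((x t).velH - P.vStar γ))
            (actCLM P.MA ((x t).velR - P.vStar γ)) -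
          inner ℝ ((x t).cable - r)
            (actCLM P.DA (((x t).velR - P.vStar γ) - ((x t).velH - P.vStar γ))) -
          inner ℝ ((x t).cable - r) (springForce P.stiffness P.len (x t).cable - γ)))
      (Set.Ici 0) t := by
  have hH := (hx.hasDerivWithinAt_velH ht).sub_const (P.vStar γ)
  have hR := (hx.hasDerivWithinAt_velR ht).sub_const (P.vStar γ)
  have hq := hx.hasDerivWithinAt_cable ht
  have hM := (actCLM P.MA).hasFDerivAt.comp_hasDerivWithinAt t hR
  have hMR := P.actCLM_MA_accR (x t) (P.velFeedback (fun _ => γ) (x t))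
  rw [velFeedback, actOn_eq_actCLM] at hMR
  have hhor : ((x t).velH - P.vStar γ) 2 = 0 := by simp [(hx t ht).1, hground]
  have hHH := P.inner_accH (x t) hhor
  have hst := P.inner_actCLM_DH_vStar γ hhor
  have hsym := P.MA_posDef.inner_actCLM_comm
    (P.accR (x t) (P.velFeedback (fun _ => γ) (x t))) ((x t).velR - P.vStar γ)
  have h := ((((hH.norm_sq).const_mul (P.massH / 2)).add ((hR.inner ℝ hM).const_mul (1 / 2))).add
    ((hasDerivWithinAt_springEnergy (k := P.stiffness) (γ := γ) P.len_pos hq htaut).sub_const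
      E₀)).add (((hq.sub_const r).inner ℝ hM).const_mul η)
  refine h.congr_deriv ?_
  simp only [Function.comp_apply]
  rw [← hsym, velFeedback, actOn_eq_actCLM, hMR]
  generalize springForce P.stiffness P.len (x t).cable = f at *
  generalize P.accH (x t) = αH at *
  have e1 : (x t).velR - (x t).velH =
    ((x t).velR - P.vStar γ) - ((x t).velH - P.vStar γ) := by abel
  have e2 : -actCLM P.DA (x t).velR - f + (γ + actCLM P.DA (x t).velH) =
      -actCLM P.DA ((x t).velR - P.vStar γ) + actCLM P.DA ((x t).velH - P.vStar γ) - (f - γ) := by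
    simp only [map_sub]; abel
  have e3 : P.massH * inner ℝ ((x t).velH - P.vStar γ) αH =
      -inner ℝ ((x t).velH - P.vStar γ) (actCLM P.DH ((x t).velH - P.vStar γ)) +
        inner ℝ ((x t).velH - P.vStar γ) (f - γ) := by
    rw [hHH, inner_sub_right _ f, map_sub, inner_sub_right _ _ (actCLM P.DH _), hst]
    ring
  rw [e2, e1]
  generalize (x t).velH - P.vStar γ = a at *
  generalize (x t).velR - P.vStar γ = b at *
  generalize f - γ = φ at *
  rw [real_inner_comm b (-actCLM P.DA b + actCLM P.DA a - φ)]
  simp only [map_sub, inner_add_right, inner_sub_right, inner_neg_right, inner_sub_left]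
  rw [real_inner_comm a φ, real_inner_comm b φ]
  -- The power of `φ` on the human and the robot cancels that stored in the spring; `e3` is the
  -- human's balance.
  linear_combination e3

/-- Local exponential convergence of the velocities and of the cable vector. -/
theorem exists_exponential_decay (P : TetherParams) {γ : Vec3} (hγ : γ ≠ 0)
    (hground : P.vStar γ 2 = 0) (hD : (P.DH - (1 / 4 : ℝ) • P.DA).PosDef) :
    ∃ ρ C μ : ℝ, 0 < ρ ∧ 0 < C ∧ 0 < μ ∧ ∀ x : ℝ → TetherState,
      P.IsMotion (P.velFeedback fun _ => γ) x → ∀ d : ℝ, d < ρ →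
      ‖(x 0).velH - P.vStar γ‖ ≤ d → ‖(x 0).velR - P.vStar γ‖ ≤ d →
      ‖(x 0).cable - restCable P.stiffness P.len γ‖ ≤ d → ∀ t ∈ Set.Ici (0 : ℝ),
        ‖(x t).velH - P.vStar γ‖ ≤ C * d * Real.exp (-μ * t) ∧
        ‖(x t).velR - P.vStar γ‖ ≤ C * d * Real.exp (-μ * t) ∧
        ‖(x t).cable - restCable P.stiffness P.len γ‖ ≤ C * d * Real.exp (-μ * t) := by
  have hk := P.stiffness_pos
  have hℓ := P.len_pos
  set v := P.vStar γ with hv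
  set r := restCable P.stiffness P.len γ with hr
  have hrℓ : P.len < ‖r‖ := lt_norm_restCable hk hℓ hγ
  have hr0 : 0 < ‖r‖ := hℓ.trans hrℓ
  have hfr : springForce P.stiffness P.len r = γ := springForce_restCable hk hℓ hγ
  have hfac : 0 < 1 - P.len / ‖r‖ := sub_pos.2 ((div_lt_one hr0).2 hrℓ)
  have hu : 0 < P.stiffness / 2 * (1 - P.len / ‖r‖) := by positivity
  obtain ⟨c₁, hc₁, h₁⟩ := hD.exists_pos_le_inner_actCLM
  obtain ⟨c₂, hc₂, h₂⟩ := P.DA_posDef.exists_pos_le_inner_actCLM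
  obtain ⟨c₃, hc₃, h₃⟩ := P.MA_posDef.exists_pos_le_inner_actCLM
  have h₁' (w : Vec3) : c₁ * ‖w‖ ^ 2 ≤ inner ℝ w (actCLM P.DH w - (1 / 4 : ℝ) • actCLM P.DA w) := by
    refine (h₁ w).trans_eq ?_
    simp only [actCLM, map_sub, map_smul]
    rfl
  obtain ⟨η, α, β, κ, hα, hβ, hκ, hlyap⟩ := exists_strict_lyapunov h₁' h₂
    P.DA_posDef.inner_actCLM_comm h₃ P.massH_pos hc₁ hc₂ hc₃ hu (half_pos hk) hu
  set ρ₀ := ‖r‖ - P.len with hρ₀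
  have hρ₀0 : 0 < ρ₀ := sub_pos.2 hrℓ
  have hs : 0 < Real.sqrt (α / (3 * β)) := Real.sqrt_pos.2 (by positivity)
  -- The radius gives `w 0 ≤ 3 * β * d ^ 2 < α * ρ₀ ^ 2`, where `ρ₀` is the margin before slackness.
  -- The energy decays at rate `κ / β`; square roots halve the rate and give `C`.
  refine ⟨min ρ₀ (ρ₀ * Real.sqrt (α / (3 * β))), Real.sqrt (3 * β / α), κ / β / 2,
    by positivity, Real.sqrt_pos.2 (by positivity), by positivity,
    fun x hx d hd hd₁ hd₂ hd₃ => ?_⟩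
  have hd0 : 0 ≤ d := (norm_nonneg _).trans hd₁
  have htaut (t : ℝ) (hg : ‖(x t).cable - r‖ ≤ ρ₀) : P.len ≤ ‖(x t).cable‖ := by
    have := norm_sub_norm_le r (x t).cable
    rw [norm_sub_rev] at this
    linarith
  have hU₁ (l : Vec3) := springEnergy_sub_ge (l := l) hk hℓ hrℓ
  have hU₂ (l : Vec3) := springEnergy_sub_le (l := l) hk hℓ hrℓ
  rw [hfr] at hU₁ hU₂
  let w : ℝ → ℝ := fun t => P.massH / 2 * ‖(x t).velH - v‖ ^ 2 +
    1 / 2 * inner ℝ ((x t).velR - v) (actCLM P.MA ((x t).velR - v)) +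
    (springEnergy P.stiffness P.len γ (x t).cable - springEnergy P.stiffness P.len γ r) +
    η * inner ℝ ((x t).cable - r) (actCLM P.MA ((x t).velR - v))
  let N : ℝ → ℝ := fun t => ‖(x t).velH - v‖ ^ 2 + ‖(x t).velR - v‖ ^ 2 + ‖(x t).cable - r‖ ^ 2
  have hlow (t : ℝ) : α * N t ≤ w t := ((hlyap _ _ _).1 _ (hU₁ _) (hU₂ _)).1
  have hupp (t : ℝ) : w t ≤ β * N t := ((hlyap _ _ _).1 _ (hU₁ _) (hU₂ _)).2
  have hN0 : N 0 ≤ 3 * d ^ 2 := by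
    have k₁ := pow_le_pow_left₀ (norm_nonneg _) hd₁ 2
    have k₂ := pow_le_pow_left₀ (norm_nonneg _) hd₂ 2
    have k₃ := pow_le_pow_left₀ (norm_nonneg _) hd₃ 2
    simp only [N]
    linarith
  have hw0 : w 0 ≤ 3 * β * d ^ 2 := by
    have := mul_le_mul_of_nonneg_left hN0 hβ.le
    linarith [hupp 0]
  have htrap := lyapunov_trapping (g := fun t => ‖(x t).cable - r‖) (w := w) (ρ := ρ₀)
    hα (div_pos hκ hβ)
    (fun t ht => ((hx.hasDerivWithinAt_cable ht).continuousWithinAt.sub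
      continuousWithinAt_const).norm)
    (fun t ht hg => hx.hasDerivWithinAt_lyapunov hground η _ ht (htaut t hg))
    (fun t _ _ => le_trans (by
      simp only [N]
      exact mul_le_mul_of_nonneg_left (le_add_of_nonneg_left (by positivity)) hα.le) (hlow t))
    (fun t _ hg => by
      have hφ := springForce_strongly_monotone hk hℓ (htaut t hg) hrℓ
      rw [hfr] at hφ
      refine ((hlyap ((x t).velH - v) ((x t).velR - v) ((x t).cable - r)).2 _ hφ).trans ?_
      have h := mul_le_mul_of_nonneg_left (hupp t) (div_pos hκ hβ).le
      have e : κ / β * (β * N t) = κ * N t := by field_simp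
      change -κ * N t ≤ _
      linarith)
    (hd₃.trans_lt (hd.trans_le (min_le_left _ _)))
    (by
      have h := pow_lt_pow_left₀ (hd.trans_le (min_le_right _ _)) hd0 two_ne_zero
      rw [mul_pow, Real.sq_sqrt (by positivity)] at h
      have h' := mul_lt_mul_of_pos_left h (show 0 < 3 * β by positivity)
      have e : 3 * β * (ρ₀ ^ 2 * (α / (3 * β))) = α * ρ₀ ^ 2 := by field_simp
      linarith)
  intro t ht
  have hNt : N t ≤ (Real.sqrt (3 * β / α) * d * Real.exp (-(κ / β / 2) * t)) ^ 2 := by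
    have h := (hlow t).trans (htrap t ht).2
    have h' : w 0 * Real.exp (-(κ / β) * t) ≤ 3 * β * d ^ 2 * Real.exp (-(κ / β) * t) := by gcongr
    rw [mul_pow, mul_pow, Real.sq_sqrt (by positivity), ← Real.exp_nat_mul]
    have e : ((2 : ℕ) : ℝ) * (-(κ / β / 2) * t) = -(κ / β) * t := by push_cast; ring
    rw [e]
    have e' : 3 * β / α * d ^ 2 * Real.exp (-(κ / β) * t) =
        3 * β * d ^ 2 * Real.exp (-(κ / β) * t) / α := by ring
    rw [e', le_div_iff₀ hα]
    linarith
  have hC : 0 ≤ Real.sqrt (3 * β / α) * d * Real.exp (-(κ / β / 2) * t) := by positivity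
  have n₁ := sq_nonneg ‖(x t).velH - v‖
  have n₂ := sq_nonneg ‖(x t).velR - v‖
  have n₃ := sq_nonneg ‖(x t).cable - r‖
  simp only [N] at hNt
  exact ⟨le_of_sq_le_sq (by linarith) hC, le_of_sq_le_sq (by linarith) hC,
    le_of_sq_le_sq (by linarith) hC⟩

/-! ### From decay to asymptotic stability. -/

section Steady

variable {P : TetherParams} {γ : Vec3} {x y : ℝ → TetherState}

theorem IsMotion.cableForce_eq_of_steady (hy : P.IsMotion (P.velFeedback fun _ => γ) y)
    (h : ∀ t : ℝ, 0 ≤ t → (y t).velH = P.vStar γ ∧ (y t).velR = P.vStar γ) {t : ℝ} (ht : 0 ≤ t) :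
    P.cableForce (y t) = γ := by
  rw [cableForce_eq_springForce, hy.springForce_eq_of_velocity_const h ht, sub_self, map_zero,
    sub_zero]

theorem IsMotion.cable_eq_of_steady (hγ : γ ≠ 0) (hy : P.IsMotion (P.velFeedback fun _ => γ) y)
    (h : ∀ t : ℝ, 0 ≤ t → (y t).velH = P.vStar γ ∧ (y t).velR = P.vStar γ) {t : ℝ} (ht : 0 ≤ t) :
    (y t).cable = restCable P.stiffness P.len γ :=
  eq_restCable P.stiffness_pos P.len_pos hγ
    (by rw [← cableForce_eq_springForce, hy.cableForce_eq_of_steady h ht])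

theorem IsMotion.hasDerivWithinAt_posH_sub (hx : P.IsMotion (P.velFeedback fun _ => γ) x)
    (hy : P.IsMotion (P.velFeedback fun _ => γ) y)
    (h : ∀ t : ℝ, 0 ≤ t → (y t).velH = P.vStar γ ∧ (y t).velR = P.vStar γ) :
    ∀ t ∈ Set.Ici (0 : ℝ), HasDerivWithinAt (fun t => (x t).posH - (y t).posH)
      ((x t).velH - P.vStar γ) (Set.Ici 0) t := fun t ht => by
  rw [← (h t ht).1]
  exact (hx.hasDerivWithinAt_posH ht).sub (hy.hasDerivWithinAt_posH ht)

/-- Motions that start close to a steady motion: the velocities and the cable vector converge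
exponentially. -/
theorem exists_exponential_decay_of_dist_lt (P : TetherParams) {γ : Vec3} (hγ : γ ≠ 0)
    (hground : P.vStar γ 2 = 0) (hD : (P.DH - (1 / 4 : ℝ) • P.DA).PosDef) :
    ∃ ρ C μ : ℝ, 0 < ρ ∧ 0 < C ∧ 0 < μ ∧ ∀ x y : ℝ → TetherState,
      P.IsMotion (P.velFeedback fun _ => γ) x → P.IsMotion (P.velFeedback fun _ => γ) y →
      (∀ t : ℝ, 0 ≤ t → (y t).velH = P.vStar γ ∧ (y t).velR = P.vStar γ) →
      ∀ d : ℝ, d < ρ → dist (x 0) (y 0) ≤ d → ∀ t ∈ Set.Ici (0 : ℝ),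
        ‖(x t).velH - P.vStar γ‖ ≤ C * d * Real.exp (-μ * t) ∧
        ‖(x t).velR - P.vStar γ‖ ≤ C * d * Real.exp (-μ * t) ∧
        ‖((x t).posR - (y t).posR) - ((x t).posH - (y t).posH)‖ ≤ C * d * Real.exp (-μ * t) := by
  obtain ⟨ρ, C, μ, hρ, hC, hμ, H⟩ := P.exists_exponential_decay hγ hground hD
  refine ⟨ρ / 2, C * 2, μ, half_pos hρ, by positivity, hμ, fun x y hx hy h d hd hxy => ?_⟩
  obtain ⟨d₁, d₂, d₃, d₄⟩ := dist_le_iff.1 hxy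
  have hd0 : 0 ≤ d := dist_nonneg.trans hxy
  have hcable (t : ℝ) (ht : 0 ≤ t) : ((x t).posR - (y t).posR) - ((x t).posH - (y t).posH) =
      (x t).cable - restCable P.stiffness P.len γ := by
    rw [← hy.cable_eq_of_steady hγ h ht, cable, cable]
    abel
  rw [(h 0 le_rfl).1] at d₂
  rw [(h 0 le_rfl).2] at d₄
  -- The cable deviation involves both positions; hence the halved radius and the doubled constant.
  have d₅ : ‖(x 0).cable - restCable P.stiffness P.len γ‖ ≤ 2 * d := by
    rw [← hcable 0 le_rfl]
    exact (norm_sub_le _ _).trans (by linarith)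
  intro t ht
  rw [hcable t ht, mul_assoc C 2 d]
  exact H x hx (2 * d) (by linarith) (by linarith) (by linarith) d₅ t ht

theorem IsMotion.isStableMotion_of_steady (hγ : γ ≠ 0) (hground : P.vStar γ 2 = 0)
    (hD : (P.DH - (1 / 4 : ℝ) • P.DA).PosDef) (hy : P.IsMotion (P.velFeedback fun _ => γ) y)
    (h : ∀ t : ℝ, 0 ≤ t → (y t).velH = P.vStar γ ∧ (y t).velR = P.vStar γ) :
    P.IsStableMotion (P.velFeedback fun _ => γ) y := by
  obtain ⟨ρ, C, μ, hρ, hC, hμ, H⟩ := P.exists_exponential_decay_of_dist_lt hγ hground hD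
  intro ε hε
  -- Initial offset, integral of the human's velocity error, and cable error, which enters the
  -- robot's position.
  set B : ℝ := 1 + C / μ + C with hB
  have hB0 : 0 < B := by positivity
  refine ⟨min ρ (ε / B), by positivity, fun x₀ h₀ hx₀ => ⟨P.exists_motion γ h₀, ?_⟩⟩
  rintro x hx rfl t ht
  set d := dist (x 0) (y 0) with hd
  have hd0 : 0 ≤ d := dist_nonneg
  have hdec := H x y hx hy h d (hx₀.trans_le (min_le_left _ _)) le_rfl
  obtain ⟨b₁, b₂, b₃⟩ := hdec t ht
  have hexp : Real.exp (-μ * t) ≤ 1 := Real.exp_le_one_iff.2 (by nlinarith)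
  have hCd : C * d * Real.exp (-μ * t) ≤ C * d := mul_le_of_le_one_right (by positivity) hexp
  have hpos := norm_sub_le_of_norm_deriv_le_exp hμ (hx.hasDerivWithinAt_posH_sub hy h)
    (fun s hs => (hdec s hs).1) le_rfl ht
  have hpos' : ‖(x t).posH - (y t).posH‖ ≤ d + C / μ * d := by
    have h1 : C * d / μ * (Real.exp (-μ * 0) - Real.exp (-μ * t)) ≤ C * d / μ * 1 := by
      gcongr
      rw [mul_zero, Real.exp_zero]
      linarith [Real.exp_pos (-μ * t)]
    have h2 := norm_le_norm_add_norm_sub' ((x t).posH - (y t).posH) ((x 0).posH - (y 0).posH)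
    have h3 := (dist_le_iff.1 hd.ge).1
    have h4 : C * d / μ * 1 = C / μ * d := by ring
    linarith
  have hposR : ‖(x t).posR - (y t).posR‖ ≤ (d + C / μ * d) + C * d := by
    have := norm_le_norm_add_norm_sub' ((x t).posR - (y t).posR) ((x t).posH - (y t).posH)
    linarith
  have hBd : B * d < ε := by
    rw [mul_comm, ← lt_div_iff₀ hB0]; exact hx₀.trans_le (min_le_right _ _)
  have p₁ : 0 ≤ C / μ * d := by positivity
  have p₂ : 0 ≤ C * d := by positivity
  have e : B * d = d + C / μ * d + C * d := by rw [hB]; ring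
  rw [dist_lt_iff, (h t ht).1, (h t ht).2]
  exact ⟨by linarith, by linarith, by linarith, by linarith⟩

/-- The vector `c` is the limit of the human's displacement from `y`, whose derivative decays
exponentially; the robot has the same limit because the cable deviation vanishes. -/
theorem IsMotion.isAttractiveMotion_of_steady (hγ : γ ≠ 0) (hground : P.vStar γ 2 = 0)
    (hD : (P.DH - (1 / 4 : ℝ) • P.DA).PosDef) (hy : P.IsMotion (P.velFeedback fun _ => γ) y)
    (h : ∀ t : ℝ, 0 ≤ t → (y t).velH = P.vStar γ ∧ (y t).velR = P.vStar γ) :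
    P.IsAttractiveMotion (P.velFeedback fun _ => γ) y := by
  obtain ⟨ρ, C, μ, hρ, hC, hμ, H⟩ := P.exists_exponential_decay_of_dist_lt hγ hground hD
  refine ⟨ρ, hρ, fun x hx hxy => ?_⟩
  set d := dist (x 0) (y 0) with hd
  have hd0 : 0 ≤ d := dist_nonneg
  have hdec := H x y hx hy h d hxy le_rfl
  obtain ⟨c, hc⟩ := exists_tendsto_of_norm_deriv_le_exp hμ (hx.hasDerivWithinAt_posH_sub hy h)
    (fun s hs => (hdec s hs).1)
  refine ⟨c, ?_⟩
  have hexp : Filter.Tendsto (fun t => C * d * Real.exp (-μ * t)) Filter.atTop (nhds 0) := by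
    have h := (Real.tendsto_exp_atBot.comp (Filter.tendsto_id.const_mul_atTop_of_neg
      (neg_neg_of_pos hμ))).const_mul (C * d)
    simpa using h
  have hc' : Filter.Tendsto (fun t => ‖(x t).posH - (y t).posH - c‖) Filter.atTop (nhds 0) :=
    tendsto_iff_norm_sub_tendsto_zero.1 hc
  have hsum := hc'.add hexp
  rw [add_zero] at hsum
  refine squeeze_zero' (Filter.Eventually.of_forall fun t => dist_nonneg) ?_ hsum
  filter_upwards [Filter.eventually_ge_atTop (0 : ℝ)] with t ht
  obtain ⟨b₁, b₂, b₃⟩ := hdec t ht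
  have p₁ := norm_nonneg ((x t).posH - (y t).posH - c)
  have p₂ : 0 ≤ C * d * Real.exp (-μ * t) := by positivity
  rw [dist_le_iff]
  refine ⟨?_, ?_, ?_, ?_⟩
  · change ‖(x t).posH - ((y t).posH + c)‖ ≤ _
    rw [← sub_sub]
    linarith
  · change ‖(x t).velH - (y t).velH‖ ≤ _
    rw [(h t ht).1]
    linarith
  · change ‖(x t).posR - ((y t).posR + c)‖ ≤ _
    have e : (x t).posR - ((y t).posR + c) = ((x t).posH - (y t).posH - c) +
        (((x t).posR - (y t).posR) - ((x t).posH - (y t).posH)) := by abel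
    rw [e]
    exact (norm_add_le _ _).trans (by linarith)
  · change ‖(x t).velR - (y t).velR‖ ≤ _
    rw [(h t ht).2]
    linarith

end Steady

end TetherParams

theorem theorem5 (P : TetherParams) (γ : Vec3) (hγ : γ ≠ 0)
    (hground : P.vStar γ 2 = 0)
    (hD : (P.DH - (1 / 4 : ℝ) • P.DA).PosDef) :
    -- from every position of the human there is a constant velocity trajectory
    (∀ a : Vec3, ∃ y : ℝ → TetherState, P.IsMotion (P.velFeedback fun _ => γ) y ∧
      (y 0).posH = a ∧ ∀ t : ℝ, 0 ≤ t → (y t).velH = P.vStar γ ∧ (y t).velR = P.vStar γ) ∧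
    -- no other velocities are possible for motions without acceleration
    (∀ y : ℝ → TetherState, P.IsMotion (P.velFeedback fun _ => γ) y →
      ∀ v w : Vec3, (∀ t : ℝ, 0 ≤ t → (y t).velH = v ∧ (y t).velR = w) →
        v = P.vStar γ ∧ w = P.vStar γ) ∧
    -- every constant velocity trajectory is asymptotically stable, with cable force `γ`
    (∀ y : ℝ → TetherState, P.IsMotion (P.velFeedback fun _ => γ) y →
      (∀ t : ℝ, 0 ≤ t → (y t).velH = P.vStar γ ∧ (y t).velR = P.vStar γ) →
        (P.IsAsymptoticallyStableMotion (P.velFeedback fun _ => γ) y ∧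
          ∀ t : ℝ, 0 ≤ t → P.cableForce (y t) = γ)) :=
  ⟨P.exists_steady_motion hγ hground,
    fun _ hy _ _ h => hy.eq_vStar_of_velocity_const hground h,
    fun _ hy h => ⟨⟨hy.isStableMotion_of_steady hγ hground hD h,
      hy.isAttractiveMotion_of_steady hγ hground hD h⟩, fun _ ht => hy.cableForce_eq_of_steady h ht⟩⟩
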